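/- Let $ABC$ be the closed solid equilateral triangle in the plane $\mathbb{C}$ with $B=0$, $C=1$, $A=e^{i\pi/3}$, and let $\mathcal{T}$ be the tessellation of the plane by equilateral triangles generated by $ABC$; its vertices are the points $m+ne^{i\pi/3}$ with $m,n\in\mathbb{Z}$. A *nonsingular trajectory* is a curve $\mathbb{R}\to ABC$ that moves along straight lines at constant positive speed, never meets a vertex, and is reflected by the law of equal angles each time it strikes a side. A *periodic orbit* is the restriction to $[a,b]$, $a<b$, of a nonsingular trajectory $\alpha$ with $\alpha(a+t)=\alpha(b+t)$ for all $t\in\mathbb{R}$ (iterates are allowed); its *period* is the number of times it strikes the sides during $[a,b)$. *Unfoldings.* After a relabelling of the vertices (moving the triangle onto itself), a change of the initial point and possibly a reversal of the parameter, let a periodic orbit $\alpha$ begin and end at a point $P$ of $\overline{BC}$ and depart from $P$ in a direction of inclination between $30^\circ$ and $60^\circ$. Suppose that after leaving $P$ it strikes successively the sides $s_1,\dots,s_k$, where $k$ is the period and the last strike is the return to $P$. For $1\le j\le k-1$ let $\sigma_j$ be the reflection in the line containing the side $(\sigma_{j-1}\cdots\sigma_1)(s_j)$ of the triangle $(\sigma_{j-1}\cdots\sigma_1)(ABC)$,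 and let $Q=(\sigma_{k-1}\cdots\sigma_1)(P)$. Every directed segment $\underline{PQ}$ that arises in this way is called an *unfolding* of $\alpha$. Two periodic orbits are *equivalent* if some unfolding of the one is a horizontal translate of some unfolding of the other. Then equivalence is an equivalence relation on the set of periodic orbits, and equivalent orbits have the same period, so the class $[\alpha]$ has a well-defined period; the class is *even* if its period is even. A point $R$ of $\overline{BC}$ is *singular* for $[\alpha]$ if the translate beginning at $R$ of an unfolding of an element of $[\alpha]$ contains a vertex of $\mathcal{T}$. There is a point $O$ on $\overline{BC}$, other than its midpoint, that is nonsingular for every even class. For every such point $O$ the following holds. For each even class $[\alpha]$ there is exactly one point $S_\alpha$ such that $\underline{OS_\alpha}$ is an unfolding of an element of $[\alpha]$. Use rhombic coordinates: $(x,y)$ denotes the point $O+x+ye^{i\pi/3}$. Then for every integer $n\ge 1$ the map that sends $[\alpha]$ to the rhombic coordinates of $S_\alpha$ is a well-defined bijection $$\Phi:\{[\alpha]\mid[\alpha]\text{ has period }2n\}\longrightarrow\{(x,y)\in\mathbb{Z}^2\mid 0\le x\le y,\ x\equiv y\ (\mathrm{mod}\ 3),\ x+y=n\}.$$ -/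

import Mathlib

open scoped Topology ComplexConjugate

noncomputable section

namespace EquilateralBilliards

/-- The vertex `A` of the equilateral triangle `ABC` with `B = 0` and `C = 1`; it is also the unit
vector of inclination 60 degrees. -/
def apex : ℂ := ⟨1 / 2, √3 / 2⟩

/-- The vertices `A`, `B`, `C` (in this order) of the billiard table. -/
def vertex : Fin 3 → ℂ := ![apex, 0, 1]

/-- The billiard table: the closed solid triangle `ABC`. -/
def table : Set ℂ := convexHull ℝ (Set.range vertex)

/-- The side opposite to the `i`-th vertex. In particular `side 0` is the horizontal side `BC`. -/
def side (i : Fin 3) : Set ℂ := segment ℝ (vertex (i + 1)) (vertex (i + 2))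

/-- The bumper, that is, the perimeter of the table. -/
def bumper : Set ℂ := ⋃ i, side i

/-- The reflection of the plane in the line through `p` and `q` (for `p ≠ q`). -/
def lineReflection (p q z : ℂ) : ℂ := p + (q - p) * conj ((z - p) / (q - p))

/-- The effect on velocities of a bounce at the `i`-th side: the linear part of the reflection in
the line containing that side. -/
def bounce (i : Fin 3) (w : ℂ) : ℂ :=
  (vertex (i + 2) - vertex (i + 1)) * conj (w / (vertex (i + 2) - vertex (i + 1)))

/-- `α` is a nonsingular billiard trajectory on the table: it never meets a vertex, it moves along
straight lines with a constant positive speed, and whenever it is on a side it strikes that side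
(it is not tangent to it) and is reflected by the law of equal angles. -/
structure IsTrajectory (α : ℝ → ℂ) : Prop where
  mem_table : ∀ t, α t ∈ table
  ne_vertex : ∀ t i, α t ≠ vertex i
  motion : ∃ v : ℝ, 0 < v ∧
    (∀ t, α t ∉ bumper →
      ∃ w : ℂ, ‖w‖ = v ∧ ∀ᶠ r in 𝓝 t, α r = α t + (r - t) • w) ∧
    (∀ t i, α t ∈ side i →
      ∃ w : ℂ, ‖w‖ = v ∧ bounce i w ≠ w ∧
        (∀ᶠ r in 𝓝[≤] t, α r = α t + (r - t) • w) ∧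
        (∀ᶠ r in 𝓝[≥] t, α r = α t + (r - t) • bounce i w))

/-- A periodic orbit: the restriction to `[initial, final]` of a periodic nonsingular trajectory that
returns after the time `final - initial`. The trajectory is determined by this restriction, so we
store all of it. Iterates are allowed: `final - initial` need not be the least time of return. -/
structure PeriodicOrbit where
  traj : ℝ → ℂ
  initial : ℝ
  final : ℝ
  initial_lt_final : initial < final
  isTrajectory : IsTrajectory traj
  periodic : ∀ t, traj (initial + t) = traj (final + t)

/-- The time that a periodic orbit takes. -/
def PeriodicOrbit.duration (α : PeriodicOrbit) : ℝ := α.final - α.initial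

/-- The period of a periodic orbit: the number of times the ball strikes the bumper. -/
def PeriodicOrbit.period (α : PeriodicOrbit) : ℕ :=
  {t | t ∈ Set.Ico α.initial α.final ∧ α.traj t ∈ bumper}.ncard

/-- `β` is obtained from the orbit `α` by relabelling the vertices of the triangle (moving the
triangle onto itself accordingly), changing the initial point, and possibly reversing the
parameter. One run of the orbit is `β` on `[0, α.duration]`. -/
def PeriodicOrbit.IsPresentation (α : PeriodicOrbit) (β : ℝ → ℂ) : Prop :=
  ∃ (π : Equiv.Perm (Fin 3)) (g : ℂ ≃ᵃⁱ[ℝ] ℂ) (c ε : ℝ),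
    (∀ i, g (vertex i) = vertex (π i)) ∧ (ε = 1 ∨ ε = -1) ∧ ∀ t, β t = g (α.traj (c + ε * t))

/-- `unfoldMap s k` is the composition of the first `k` reflections `σₖ ∘ ⋯ ∘ σ₁` of the unfolding
process, when the sides struck in succession are the sides number `s 0, s 1, …`: the reflection
`σₖ₊₁` is the one in the line containing the side number `s k` of the image of the triangle
`ABC` under `σₖ ∘ ⋯ ∘ σ₁`. -/
def unfoldMap (s : ℕ → Fin 3) : ℕ → ℂ → ℂ
  | 0 => id
  | k + 1 => lineReflection (unfoldMap s k (vertex (s k + 1))) (unfoldMap s k (vertex (s k + 2)))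
      ∘ unfoldMap s k

/-- The directed segment from `P` to `Q` is an unfolding of `α`: for some presentation `β` of `α`
that starts at the point `P` of `BC` and departs at an angle between 30 and 60 degrees (with
positive components), whose strikes during one run are at the times `0 = t₀ < t₁ < ⋯ < tₘ₊₁`, the
last one being the return to `P`, and are on the sides number `s 0, …, s m` after the departure, we
have `Q = σₘ ⋯ σ₁ (P)`. -/
def IsUnfolding (α : PeriodicOrbit) (P Q : ℂ) : Prop :=
  ∃ β : ℝ → ℂ, α.IsPresentation β ∧ β 0 = P ∧ P ∈ side 0 ∧
    (∃ w : ℂ, (∀ᶠ r : ℝ in 𝓝[≥] 0, β r = P + r • w) ∧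
      Real.pi / 6 ≤ Complex.arg w ∧ Complex.arg w ≤ Real.pi / 3) ∧
    ∃ (m : ℕ) (t : ℕ → ℝ) (s : ℕ → Fin 3),
      t 0 = 0 ∧ t (m + 1) = α.duration ∧ (∀ i ≤ m, t i < t (i + 1)) ∧
      (∀ r ∈ Set.Icc 0 α.duration, β r ∈ bumper ↔ ∃ i ≤ m + 1, t i = r) ∧
      (∀ i ≤ m, β (t (i + 1)) ∈ side (s i)) ∧
      Q = unfoldMap s m P

/-- Two periodic orbits are equivalent if some unfolding of one is a horizontal translate of some
unfolding of the other. -/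
def OrbitEquiv (α β : PeriodicOrbit) : Prop :=
  ∃ P Q R S : ℂ, IsUnfolding α P Q ∧ IsUnfolding β R S ∧ ∃ h : ℝ, R = P + h ∧ S = Q + h

/-- The equivalence classes of periodic orbits. -/
def OrbitClass : Type := Quot OrbitEquiv

/-- The class of a periodic orbit. -/
def PeriodicOrbit.toClass (α : PeriodicOrbit) : OrbitClass := Quot.mk OrbitEquiv α

/-- The class `c` has period `k`: its elements have period `k`. -/
def OrbitClass.HasPeriod (c : OrbitClass) (k : ℕ) : Prop :=
  ∀ α : PeriodicOrbit, α.toClass = c → α.period = k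

/-- A class is even if it has an even period. -/
def OrbitClass.IsEven (c : OrbitClass) : Prop := ∃ k, Even k ∧ c.HasPeriod k

/-- The vertices of the tessellation of the plane by translates and reflected copies of `ABC`. -/
def tessellationVertices : Set ℂ := {z | ∃ m n : ℤ, z = m + n * apex}

/-- The point `R` is singular for the class `c`: an unfolding of an element of `c`, translated so
that it begins at `R`, contains a vertex of the tessellation. -/
def IsSingularFor (R : ℂ) (c : OrbitClass) : Prop :=
  ∃ (α : PeriodicOrbit) (P Q : ℂ), α.toClass = c ∧ IsUnfolding α P Q ∧
    ∃ z ∈ segment ℝ R (R + (Q - P)), z ∈ tessellationVertices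

/-- An origin for fundamental unfoldings: a point of `BC` other than its midpoint that is
nonsingular for every even class. -/
def IsOrigin (O : ℂ) : Prop :=
  O ∈ side 0 ∧ O ≠ midpoint ℝ (vertex 1) (vertex 2) ∧
    ∀ c : OrbitClass, c.IsEven → ¬ IsSingularFor O c

/-- The directed segment from `O` to `S` is a fundamental unfolding of the class `c`: it is an
unfolding of some element of `c`. -/
def IsFundamentalUnfolding (O : ℂ) (c : OrbitClass) (S : ℂ) : Prop :=
  ∃ α : PeriodicOrbit, α.toClass = c ∧ IsUnfolding α O S

/-- The point with rhombic coordinates `(x, y)` with respect to the origin `O`: the first axis is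
horizontal, the second one has inclination 60 degrees, and `BC` is the unit of length. -/
def rhombicPoint (O : ℂ) (x y : ℝ) : ℂ := O + x + y * apex

/-- The integer points `(x, y)` with `0 ≤ x ≤ y`, `x ≡ y (mod 3)` and `x + y = n`. -/
def latticePoints (n : ℕ) : Set (ℤ × ℤ) :=
  {p | 0 ≤ p.1 ∧ p.1 ≤ p.2 ∧ p.1 ≡ p.2 [ZMOD 3] ∧ p.1 + p.2 = n}

end EquilateralBilliards

end

open scoped Topology ComplexConjugate

noncomputable section

namespace EquilateralBilliards

/-! ### Rhombic and barycentric coordinates -/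

/-! Let `weyl` be the group generated by the reflections in the lines of the tessellation. The
closed triangle contains exactly one point of each of its orbits (`exists_cong_mem_table`,
`Cong.eq_of_mem_table`), so the plane folds onto the triangle by `fold`. Under this folding
nonsingular trajectories are precisely the images of straight lines that avoid the vertices
(`IsTrajectory.exists_line`, `isTrajectory_fold`), and strikes are crossings with the grid.

If an orbit returns after time `T`, one element of `weyl` shifts its unfolded line along itself by
`T`. This element is a translation by a vector `m + n * apex` with `m ≡ n (mod 3)`, or a glide
reflection (`exists_translation`). Counting the crossings with each of the three families of grid
lines shows that the period is the hexagonal norm of the displacement (`PeriodicOrbit.period_eq`).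

Up to sign, the linear parts of the symmetries form a group of order 12, with the 30 degree cone as
fundamental domain. Hence all unfoldings of one orbit have the same displacement `D`, with rhombic
coordinates `0 ≤ x ≤ y` and period `2 * (x + y)` (`PeriodicOrbit.exists_disp`). A glide reflection
with axis in the cone forces `x = 0`; if moreover the period is even, divisibility puts `D` in
`rootLattice` anyway (`PeriodicOrbit.disp_mem_of_even`). Since unfoldings start on a horizontal
side, equivalence is equality of displacements (`orbitEquiv_iff`), and even classes give lattice
points.

Conversely, if `D` is a nonzero vector of `rootLattice` in the cone and the segment from `O` to `O +
D` avoids the vertices, folding the line through it gives a periodic orbit with this unfolding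
(`exists_orbit`). An irrational starting point avoids the vertices for every `D`, which provides
both an admissible `O` and surjectivity. -/

lemma sqrt_three_mul_self : √3 * √3 = (3 : ℝ) := Real.mul_self_sqrt (by norm_num)

lemma sqrt_three_pos : 0 < √(3 : ℝ) := Real.sqrt_pos.2 (by norm_num)

lemma apex_sq : apex ^ 2 = apex - 1 := by
  have := sqrt_three_mul_self
  rw [sq]
  apply Complex.ext
  · simp [apex]; linarith
  · simp [apex]; ring

lemma conj_apex : conj apex = 1 - apex := by
  apply Complex.ext
  · simp [apex]; norm_num
  · simp [apex]

/-- The first rhombic coordinate. -/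
def cx : ℂ →ₗ[ℝ] ℝ := Complex.reLm - (1 / √3) • Complex.imLm

/-- The second rhombic coordinate. -/
def cy : ℂ →ₗ[ℝ] ℝ := (2 / √3) • Complex.imLm

lemma cx_def (z : ℂ) : cx z = z.re - z.im / √3 := by simp [cx]; ring

lemma cy_def (z : ℂ) : cy z = 2 * z.im / √3 := by simp [cy]; ring

lemma eq_cx_add_cy (z : ℂ) : z = cx z + cy z * apex := by
  have := sqrt_three_pos
  apply Complex.ext
  · simp [apex, cx_def, cy_def]; field_simp; ring
  · simp [apex, cx_def, cy_def]; field_simp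

lemma ext_coords {z z' : ℂ} (h1 : cx z = cx z') (h2 : cy z = cy z') : z = z' := by
  rw [eq_cx_add_cy z, eq_cx_add_cy z', h1, h2]

@[simp] lemma cx_ofReal (x : ℝ) : cx x = x := by simp [cx_def]

@[simp] lemma cy_ofReal (x : ℝ) : cy x = 0 := by simp [cy_def]

@[simp] lemma cx_one : cx 1 = 1 := by simp [cx_def]

@[simp] lemma cy_one : cy 1 = 0 := by simp [cy_def]

@[simp] lemma cx_intCast (x : ℤ) : cx x = x := by simp [cx_def]

@[simp] lemma cy_intCast (x : ℤ) : cy x = 0 := by simp [cy_def]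

@[simp] lemma cx_apex : cx apex = 0 := by
  have := sqrt_three_pos
  simp [cx_def, apex]; field_simp; norm_num

@[simp] lemma cy_apex : cy apex = 1 := by
  have := sqrt_three_pos
  simp [cy_def, apex]; field_simp

lemma cx_ofReal_mul (x : ℝ) (z : ℂ) : cx (x * z) = x * cx z := by
  rw [← Complex.real_smul, map_smul, smul_eq_mul]

lemma cy_ofReal_mul (x : ℝ) (z : ℂ) : cy (x * z) = x * cy z := by
  rw [← Complex.real_smul, map_smul, smul_eq_mul]

@[simp] lemma cx_real_add_mul (x y : ℝ) : cx (x + y * apex) = x := by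
  rw [map_add, cx_ofReal_mul]; simp

@[simp] lemma cy_real_add_mul (x y : ℝ) : cy (x + y * apex) = y := by
  rw [map_add, cy_ofReal_mul]; simp

@[simp] lemma cx_int_add_mul (x y : ℤ) : cx (x + y * apex) = x := by
  simpa using cx_real_add_mul x y

@[simp] lemma cy_int_add_mul (x y : ℤ) : cy (x + y * apex) = y := by
  simpa using cy_real_add_mul x y

@[simp] lemma cx_apex_mul (z : ℂ) : cx (apex * z) = - cy z := by
  have h : apex * z = ((-cy z : ℝ) : ℂ) + ((cx z + cy z : ℝ) : ℂ) * apex := by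
    conv_lhs => rw [eq_cx_add_cy z]
    push_cast
    linear_combination (cy z : ℂ) * apex_sq
  rw [h, cx_real_add_mul]

@[simp] lemma cy_apex_mul (z : ℂ) : cy (apex * z) = cx z + cy z := by
  have h : apex * z = ((-cy z : ℝ) : ℂ) + ((cx z + cy z : ℝ) : ℂ) * apex := by
    conv_lhs => rw [eq_cx_add_cy z]
    push_cast
    linear_combination (cy z : ℂ) * apex_sq
  rw [h, cy_real_add_mul]

@[simp] lemma cx_conj (z : ℂ) : cx (conj z) = cx z + cy z := by
  simp [cx_def, cy_def]; ring

@[simp] lemma cy_conj (z : ℂ) : cy (conj z) = - cy z := by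
  simp [cy_def]; ring

/-- The barycentric coordinates with respect to the vertices of the table. -/
def bary (i : Fin 3) (z : ℂ) : ℝ := ![cy z, 1 - cx z - cy z, cx z] i

/-- The linear parts of the barycentric coordinates. -/
def slope (i : Fin 3) (w : ℂ) : ℝ := ![cy w, - cx w - cy w, cx w] i

lemma bary_line (i : Fin 3) (p w : ℂ) (t : ℝ) :
    bary i (p + t • w) = bary i p + t * slope i w := by
  fin_cases i <;> simp [bary, slope, -Complex.real_smul]; ring

lemma continuous_bary (i : Fin 3) : Continuous (bary i) := by
  have h1 : Continuous cx := cx.continuous_of_finiteDimensional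
  have h2 : Continuous cy := cy.continuous_of_finiteDimensional
  unfold bary
  fin_cases i <;> simp <;> fun_prop

lemma eq_sum_bary (z : ℂ) : z = bary 0 z • vertex 0 + bary 1 z • vertex 1 + bary 2 z • vertex 2 := by
  conv_lhs => rw [eq_cx_add_cy z]
  simp [bary, vertex]; ring

lemma sum_bary (z : ℂ) : bary 0 z + bary 1 z + bary 2 z = 1 := by
  simp [bary]

lemma mem_table {z : ℂ} : z ∈ table ↔ ∀ i, 0 ≤ bary i z := by
  constructor
  · intro hz
    have : table ⊆ {z | ∀ i, 0 ≤ bary i z} := by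
      apply convexHull_min
      · rintro _ ⟨i, rfl⟩ j
        fin_cases i <;> fin_cases j <;> simp [bary, vertex]
      · intro p hp q hq a b ha hb hab j
        have e : bary j (a • p + b • q) = a * bary j p + b * bary j q := by
          obtain rfl : a = 1 - b := by linarith
          fin_cases j <;> simp [bary, -Complex.real_smul]; ring
        rw [e]
        have := hp j
        have := hq j
        positivity
    exact this hz
  · intro h
    have hv : ∀ i, vertex i ∈ table := fun i => subset_convexHull ℝ _ ⟨i, rfl⟩
    have := (convex_convexHull ℝ (Set.range vertex)).sum_mem (t := Finset.univ)
      (w := fun i => bary i z) (z := vertex) (fun i _ => h i)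
      (by rw [Fin.sum_univ_three]; exact sum_bary z) (fun i _ => hv i)
    rw [Fin.sum_univ_three, ← eq_sum_bary] at this
    exact this

lemma mem_side {i : Fin 3} {z : ℂ} : z ∈ side i ↔ z ∈ table ∧ bary i z = 0 := by
  rw [mem_table]
  constructor
  · rintro ⟨a, b, ha, hb, hab, rfl⟩
    obtain rfl : a = 1 - b := by linarith
    constructor
    · intro j
      fin_cases i <;> fin_cases j <;> simp [bary, vertex, -Complex.real_smul] <;> linarith
    · fin_cases i <;> simp [bary, vertex, -Complex.real_smul]
  · rintro ⟨h, h0⟩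
    refine ⟨bary (i + 1) z, bary (i + 2) z, h _, h _, ?_, ?_⟩
    · have := sum_bary z
      fin_cases i <;> simp at h0 ⊢ <;> linarith
    · have := eq_sum_bary z
      fin_cases i <;> simp at h0 ⊢ <;> rw [h0] at this <;> simp at this
      · exact this.symm
      · rw [add_comm]; exact this.symm
      · exact this.symm

lemma mem_bumper {z : ℂ} : z ∈ bumper ↔ z ∈ table ∧ ∃ i, bary i z = 0 := by
  simp [bumper, mem_side]

/-! ### The affine Weyl group of the tessellation -/

/-- The vertices of the tessellation, as a lattice. -/
def vertexLattice : AddSubgroup ℂ where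
  carrier := {z | ∃ m n : ℤ, z = m + n * apex}
  add_mem' := by
    rintro _ _ ⟨m, n, rfl⟩ ⟨m', n', rfl⟩
    exact ⟨m + m', n + n', by push_cast; ring⟩
  zero_mem' := ⟨0, 0, by simp⟩
  neg_mem' := by
    rintro _ ⟨m, n, rfl⟩
    exact ⟨-m, -n, by push_cast; ring⟩

/-- The translations in the group generated by the reflections in the lines of the tessellation. -/
def rootLattice : AddSubgroup ℂ where
  carrier := {z | ∃ m n : ℤ, 3 ∣ m - n ∧ z = m + n * apex}
  add_mem' := by
    rintro _ _ ⟨m, n, h, rfl⟩ ⟨m', n', h', rfl⟩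
    exact ⟨m + m', n + n', by omega, by push_cast; ring⟩
  zero_mem' := ⟨0, 0, by simp⟩
  neg_mem' := by
    rintro _ ⟨m, n, h, rfl⟩
    exact ⟨-m, -n, by omega, by push_cast; ring⟩

lemma mem_vertexLattice {z : ℂ} : z ∈ vertexLattice ↔ ∃ m n : ℤ, z = m + n * apex := Iff.rfl

lemma rootLattice_le : rootLattice ≤ vertexLattice := by
  rintro _ ⟨m, n, -, rfl⟩
  exact ⟨m, n, rfl⟩

lemma cube_root_cases {u : ℂ} (hu : u ^ 3 = 1) : u = 1 ∨ u = apex - 1 ∨ u = -apex := by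
  have : (u - 1) * ((u - (apex - 1)) * (u + apex)) = 0 := by
    linear_combination hu - (u - 1) * apex_sq
  rcases mul_eq_zero.1 this with h | h
  · exact Or.inl (sub_eq_zero.1 h)
  rcases mul_eq_zero.1 h with h | h
  · exact Or.inr (Or.inl (sub_eq_zero.1 h))
  · exact Or.inr (Or.inr (eq_neg_of_add_eq_zero_left h))

lemma apex_cube : apex ^ 3 = -1 := by linear_combination (apex + 1) * apex_sq

lemma apex_sub_one_cube : (apex - 1) ^ 3 = 1 := by linear_combination (apex - 2) * apex_sq

lemma neg_apex_cube : (-apex) ^ 3 = 1 := by linear_combination - apex_cube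

lemma conj_cube_root {u : ℂ} (hu : u ^ 3 = 1) : conj u = u ^ 2 := by
  rcases cube_root_cases hu with rfl | rfl | rfl
  · simp
  · rw [map_sub, conj_apex, map_one]; linear_combination - apex_sq
  · rw [map_neg, conj_apex]; linear_combination - apex_sq

/-- In the ring of Eisenstein integers `vertexLattice`, the root lattice is the ideal of index 3
generated by `√-3`, and it contains `u - 1` for every cube root of unity `u`. -/
lemma cube_root_mul_sub_mem {u z : ℂ} (hu : u ^ 3 = 1) (hz : z ∈ vertexLattice) :
    u * z - z ∈ rootLattice := by
  obtain ⟨m, n, rfl⟩ := hz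
  rcases cube_root_cases hu with rfl | rfl | rfl
  · simp
  · exact ⟨-2 * m - n, m - n, by omega, by push_cast; linear_combination (n : ℂ) * apex_sq⟩
  · exact ⟨n - m, - m - 2 * n, by omega, by push_cast; linear_combination - (n : ℂ) * apex_sq⟩

lemma conj_sub_mem {z : ℂ} (hz : z ∈ vertexLattice) : conj z - z ∈ rootLattice := by
  obtain ⟨m, n, rfl⟩ := hz
  refine ⟨n, -2 * n, by omega, ?_⟩
  simp [conj_apex]; ring

/-- The linear maps that are multiplications by cube roots of unity, possibly preceded by the
complex conjugation. -/
def IsSpecial (f : ℂ → ℂ) : Prop :=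
  ∃ u : ℂ, u ^ 3 = 1 ∧ ((∀ z, f z = u * z) ∨ ∀ z, f z = u * conj z)

lemma IsSpecial.sub_mem {f : ℂ → ℂ} (hf : IsSpecial f) {z : ℂ} (hz : z ∈ vertexLattice) :
    f z - z ∈ rootLattice := by
  obtain ⟨u, hu, h | h⟩ := hf
  · rw [h]; exact cube_root_mul_sub_mem hu hz
  · rw [h]
    have h1 := conj_sub_mem hz
    have h2 : conj z ∈ vertexLattice := by
      simpa using vertexLattice.add_mem (rootLattice_le h1) hz
    simpa using rootLattice.add_mem (cube_root_mul_sub_mem hu h2) h1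

lemma isom_mul_apply (g h : ℂ ≃ᵃⁱ[ℝ] ℂ) (z : ℂ) : (g * h) z = g (h z) := by simp

lemma isom_apply_inv (g : ℂ ≃ᵃⁱ[ℝ] ℂ) (z : ℂ) : g (g⁻¹ z) = z := by
  rw [← isom_mul_apply, mul_inv_cancel]; rfl

lemma isom_inv_apply (g : ℂ ≃ᵃⁱ[ℝ] ℂ) (z : ℂ) : g⁻¹ (g z) = z := by
  rw [← isom_mul_apply, inv_mul_cancel]; rfl

/-- The isometries of the plane that preserve the tessellation and have a special linear part. -/
def extWeyl : Subgroup (ℂ ≃ᵃⁱ[ℝ] ℂ) where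
  carrier := {g | g 0 ∈ vertexLattice ∧ IsSpecial fun z => g z - g 0}
  one_mem' := ⟨by simp, 1, by simp, Or.inl fun z => by simp⟩
  mul_mem' := by
    rintro g h ⟨hg0, hg⟩ ⟨hh0, hh⟩
    refine ⟨?_, ?_⟩
    · have := vertexLattice.add_mem (vertexLattice.add_mem (rootLattice_le (hg.sub_mem hh0)) hh0) hg0
      simpa using this
    · obtain ⟨u, hu, hgu⟩ := hg
      obtain ⟨v, hv, hhv⟩ := hh
      have hc := conj_cube_root hv
      simp only [sub_eq_iff_eq_add] at hgu hhv
      simp only [AffineIsometryEquiv.coe_mul, Function.comp_apply]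
      rcases hgu with hgu | hgu <;> rcases hhv with hhv | hhv
      · exact ⟨u * v, by rw [mul_pow, hu, hv, one_mul], Or.inl fun z => by
          show g (h z) - g (h 0) = _; rw [hgu (h z), hgu (h 0), hhv z]; ring⟩
      · exact ⟨u * v, by rw [mul_pow, hu, hv, one_mul], Or.inr fun z => by
          show g (h z) - g (h 0) = _; rw [hgu (h z), hgu (h 0), hhv z]; ring⟩
      · exact ⟨u * v ^ 2, by rw [mul_pow, ← pow_mul, mul_comm 2 3, pow_mul, hu, hv]; simp,
          Or.inr fun z => by show g (h z) - g (h 0) = _; rw [hgu (h z), hgu (h 0), hhv z, map_add, map_mul, hc]; ring⟩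
      · exact ⟨u * v ^ 2, by rw [mul_pow, ← pow_mul, mul_comm 2 3, pow_mul, hu, hv]; simp,
          Or.inl fun z => by
            show g (h z) - g (h 0) = _; rw [hgu (h z), hgu (h 0), hhv z, map_add, map_mul, hc, Complex.conj_conj]; ring⟩
  inv_mem' := by
    rintro g ⟨hg0, u, hu, hgu⟩
    have hinv : ∀ z, g (g⁻¹ z) = z := isom_apply_inv g
    have hc := conj_cube_root hu
    simp only [sub_eq_iff_eq_add] at hgu
    have hsp : IsSpecial fun z => g⁻¹ z - g⁻¹ 0 := by
      rcases hgu with hgu | hgu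
      · have key : ∀ z, g⁻¹ z = u ^ 2 * (z - g 0) := fun z => by
          have := hinv z
          rw [hgu] at this
          linear_combination - g⁻¹ z * hu + u ^ 2 * this
        exact ⟨u ^ 2, by rw [← pow_mul, mul_comm 2 3, pow_mul, hu]; simp, Or.inl fun z => by
          show g⁻¹ z - g⁻¹ 0 = _; rw [key z, key 0]; ring⟩
      · have key : ∀ z, g⁻¹ z = u * conj (z - g 0) := fun z => by
          have := congrArg conj (hinv z)
          rw [hgu, map_add, map_mul, hc, Complex.conj_conj] at this
          rw [map_sub]
          linear_combination - g⁻¹ z * hu + u * this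
        exact ⟨u, hu, Or.inr fun z => by show g⁻¹ z - g⁻¹ 0 = _; rw [key z, key 0]; simp; ring⟩
    refine ⟨?_, hsp⟩
    have h1 := rootLattice_le (hsp.sub_mem hg0)
    have h2 : g⁻¹ (g 0) = 0 := isom_inv_apply g 0
    rw [h2] at h1
    have := vertexLattice.neg_mem (vertexLattice.add_mem h1 hg0)
    simpa using this

/-- Modulo the root lattice, the elements of `extWeyl` act on the vertices as translations. -/
lemma extWeyl_sub_mem {g : ℂ ≃ᵃⁱ[ℝ] ℂ} (hg : g ∈ extWeyl) {z : ℂ} (hz : z ∈ vertexLattice) :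
    g z - g 0 - z ∈ rootLattice := hg.2.sub_mem hz

lemma extWeyl_apply_mem {g : ℂ ≃ᵃⁱ[ℝ] ℂ} (hg : g ∈ extWeyl) {z : ℂ} :
    g z ∈ vertexLattice ↔ z ∈ vertexLattice := by
  have key : ∀ {g : ℂ ≃ᵃⁱ[ℝ] ℂ}, g ∈ extWeyl → ∀ {z : ℂ}, z ∈ vertexLattice →
      g z ∈ vertexLattice := fun {g} hg {z} hz => by
    have := vertexLattice.add_mem (vertexLattice.add_mem
      (rootLattice_le (extWeyl_sub_mem hg hz)) hz) hg.1
    simpa using this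
  refine ⟨fun h => ?_, key hg⟩
  have := key (inv_mem hg) h
  rwa [isom_inv_apply] at this

/-- The group generated by the reflections in the lines of the tessellation. -/
def weyl : Subgroup (ℂ ≃ᵃⁱ[ℝ] ℂ) where
  carrier := {g | g ∈ extWeyl ∧ g 0 ∈ rootLattice}
  one_mem' := ⟨one_mem _, by simp⟩
  mul_mem' := by
    rintro g h ⟨hg, hg0⟩ ⟨hh, hh0⟩
    refine ⟨mul_mem hg hh, ?_⟩
    have := rootLattice.add_mem (rootLattice.add_mem (extWeyl_sub_mem hg hh.1) hh0) hg0
    simpa using this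
  inv_mem' := by
    rintro g ⟨hg, hg0⟩
    refine ⟨inv_mem hg, ?_⟩
    have := rootLattice.neg_mem
      (rootLattice.add_mem (extWeyl_sub_mem (inv_mem hg) hg.1) hg0)
    rw [isom_inv_apply] at this
    simpa using this

lemma weyl_le : weyl ≤ extWeyl := fun _ h => h.1

/-- Modulo the root lattice, elements of `extWeyl` act on vertices as translations. Translations
commute, so conjugation does not change the class of the translation part. -/
lemma conj_mem_weyl {g h : ℂ ≃ᵃⁱ[ℝ] ℂ} (hg : g ∈ extWeyl) (hh : h ∈ weyl) :
    g * h * g⁻¹ ∈ weyl := by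
  refine ⟨mul_mem (mul_mem hg hh.1) (inv_mem hg), ?_⟩
  have h0 : g⁻¹ 0 ∈ vertexLattice := (inv_mem hg).1
  have h1 := extWeyl_sub_mem hg ((extWeyl_apply_mem hh.1).2 h0)
  have h2 := extWeyl_sub_mem hh.1 h0
  have h3 := extWeyl_sub_mem hg h0
  rw [isom_apply_inv] at h3
  have := rootLattice.add_mem (rootLattice.sub_mem (rootLattice.add_mem h1 h2) h3) hh.2
  rw [isom_mul_apply, isom_mul_apply]
  convert this using 1
  ring

lemma extWeyl_form {g : ℂ ≃ᵃⁱ[ℝ] ℂ} (hg : g ∈ extWeyl) :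
    ∃ u : ℂ, u ^ 3 = 1 ∧ ((∀ z, g z = u * z + g 0) ∨ ∀ z, g z = u * conj z + g 0) := by
  obtain ⟨-, u, hu, h⟩ := hg
  simp only [sub_eq_iff_eq_add] at h
  exact ⟨u, hu, h⟩

lemma exists_isom_mul {u : ℂ} (hu : u ^ 3 = 1) (c : ℂ) :
    ∃ g : ℂ ≃ᵃⁱ[ℝ] ℂ, ∀ z, g z = u * z + c := by
  have h1 : ‖u‖ = 1 := by
    have : ‖u‖ ^ 3 = 1 := by rw [← norm_pow, hu, norm_one]
    exact (pow_eq_one_iff_of_nonneg (norm_nonneg u) (by norm_num)).1 this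
  refine ⟨(rotation ⟨u, by simpa [Submonoid.unitSphere] using h1⟩).toAffineIsometryEquiv.trans
    (AffineIsometryEquiv.constVAdd ℝ ℂ c), fun z => ?_⟩
  simp only [AffineIsometryEquiv.coe_trans, Function.comp_apply, LinearIsometryEquiv.coe_toAffineIsometryEquiv,
    AffineIsometryEquiv.coe_constVAdd, vadd_eq_add]
  exact add_comm _ _

lemma exists_isom_mul_conj {u : ℂ} (hu : u ^ 3 = 1) (c : ℂ) :
    ∃ g : ℂ ≃ᵃⁱ[ℝ] ℂ, ∀ z, g z = u * conj z + c := by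
  obtain ⟨g, hg⟩ := exists_isom_mul hu c
  exact ⟨Complex.conjLIE.toAffineIsometryEquiv.trans g, fun z => by simp [hg]⟩

lemma exists_mem_extWeyl_mul {u c : ℂ} (hu : u ^ 3 = 1) (hc : c ∈ vertexLattice) :
    ∃ g ∈ extWeyl, ∀ z, g z = u * z + c := by
  obtain ⟨g, hg⟩ := exists_isom_mul hu c
  exact ⟨g, ⟨by simpa [hg] using hc, u, hu, Or.inl fun z => by simp [hg]⟩, hg⟩

lemma exists_mem_extWeyl_mul_conj {u c : ℂ} (hu : u ^ 3 = 1) (hc : c ∈ vertexLattice) :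
    ∃ g ∈ extWeyl, ∀ z, g z = u * conj z + c := by
  obtain ⟨g, hg⟩ := exists_isom_mul_conj hu c
  exact ⟨g, ⟨by simpa [hg] using hc, u, hu, Or.inr fun z => by simp [hg]⟩, hg⟩

/-- The elements of `extWeyl` in rhombic coordinates. -/
lemma extWeyl_coords {g : ℂ ≃ᵃⁱ[ℝ] ℂ} (hg : g ∈ extWeyl) : ∃ m n : ℤ, g 0 = m + n * apex ∧
    ((∀ z, cx (g z) = cx z + m ∧ cy (g z) = cy z + n) ∨
     (∀ z, cx (g z) = - cx z - cy z + m ∧ cy (g z) = cx z + n) ∨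
     (∀ z, cx (g z) = cy z + m ∧ cy (g z) = - cx z - cy z + n) ∨
     (∀ z, cx (g z) = cx z + cy z + m ∧ cy (g z) = - cy z + n) ∨
     (∀ z, cx (g z) = - cx z + m ∧ cy (g z) = cx z + cy z + n) ∨
     (∀ z, cx (g z) = - cy z + m ∧ cy (g z) = - cx z + n)) := by
  obtain ⟨m, n, h0⟩ := hg.1
  obtain ⟨u, hu, h⟩ := extWeyl_form hg
  have hm : cx (g 0) = m := by rw [h0]; simp
  have hn : cy (g 0) = n := by rw [h0]; simp
  refine ⟨m, n, h0, ?_⟩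
  rcases h with h | h <;> rcases cube_root_cases hu with rfl | rfl | rfl
  · exact Or.inl fun z => by rw [h, map_add, map_add, hm, hn, one_mul]; simp
  · exact Or.inr <| Or.inl fun z => by
      rw [h, map_add, map_add, hm, hn, sub_one_mul]; simp; ring
  · exact Or.inr <| Or.inr <| Or.inl fun z => by
      rw [h, map_add, map_add, hm, hn, neg_mul]; simp; ring
  · exact Or.inr <| Or.inr <| Or.inr <| Or.inl fun z => by
      rw [h, map_add, map_add, hm, hn, one_mul]; simp
  · exact Or.inr <| Or.inr <| Or.inr <| Or.inr <| Or.inl fun z => by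
      rw [h, map_add, map_add, hm, hn, sub_one_mul]; simp
  · exact Or.inr <| Or.inr <| Or.inr <| Or.inr <| Or.inr fun z => by
      rw [h, map_add, map_add, hm, hn, neg_mul]; simp

/-- In the equilateral triangle the mirror image of a point is found by moving perpendicularly to
the side, so the change of twice the `i`-th barycentric coordinate is shared equally by the other
two. The barycentric form is what later arguments use; the first one connects with the unfolding
process. -/
lemma exists_refl (i : Fin 3) : ∃ g ∈ weyl,
    (∀ z, g z = lineReflection (vertex (i + 1)) (vertex (i + 2)) z) ∧
    ∀ j z, bary j (g z) = if j = i then - bary i z else bary j z + bary i z := by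
  have h0 : apex ≠ 0 := fun h => by simpa [h] using apex_sq
  have h1 : apex - 1 ≠ 0 := fun h => by
    have := apex_sq
    rw [sub_eq_zero.1 h] at this
    norm_num at this
  have key : ∀ g ∈ extWeyl, g 0 ∈ rootLattice →
      (∀ z, g z = lineReflection (vertex (i + 1)) (vertex (i + 2)) z) →
      (∀ j z, bary j (g z) = if j = i then - bary i z else bary j z + bary i z) →
      ∃ g ∈ weyl, (∀ z, g z = lineReflection (vertex (i + 1)) (vertex (i + 2)) z) ∧
    ∀ j z, bary j (g z) = if j = i then - bary i z else bary j z + bary i z :=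
    fun g h1 h2 h3 h4 => ⟨g, ⟨h1, h2⟩, h3, h4⟩
  fin_cases i
  · obtain ⟨g, hg, h⟩ := exists_mem_extWeyl_mul_conj (u := 1) (by simp) vertexLattice.zero_mem
    refine key g hg (by simp [h]) (fun z => ?_) fun j z => ?_
    · simp [h, lineReflection, vertex]
    · rw [h]; fin_cases j <;> simp [bary]; all_goals ring
  · obtain ⟨g, hg, h⟩ := exists_mem_extWeyl_mul_conj (u := -apex) (c := 1 + apex) neg_apex_cube
      ⟨1, 1, by simp⟩
    refine key g hg (by simpa [h] using ⟨1, 1, by simp, by simp⟩) (fun z => ?_) fun j z => ?_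
    · have h2 : 1 - apex - 1 ≠ 0 := by simpa using h0
      simp [h, lineReflection, vertex, conj_apex]
      field_simp
      linear_combination (1 - conj z) * apex_sq
    · rw [h, neg_mul]; fin_cases j <;> simp [bary]; all_goals ring
  · obtain ⟨g, hg, h⟩ := exists_mem_extWeyl_mul_conj (u := apex - 1) apex_sub_one_cube
      vertexLattice.zero_mem
    refine key g hg (by simp [h]) (fun z => ?_) fun j z => ?_
    · have h2 : 1 - apex ≠ 0 := by rw [← neg_sub]; exact neg_ne_zero.2 h1
      simp [h, lineReflection, vertex, conj_apex]
      field_simp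
      linear_combination (conj z) * apex_sq
    · rw [h, sub_one_mul]; fin_cases j <;> simp [bary]; all_goals ring

/-- The reflection in the line containing the `i`-th side of the table. -/
def refl (i : Fin 3) : ℂ ≃ᵃⁱ[ℝ] ℂ := (exists_refl i).choose

lemma refl_mem (i : Fin 3) : refl i ∈ weyl := (exists_refl i).choose_spec.1

lemma refl_apply (i : Fin 3) (z : ℂ) :
    refl i z = lineReflection (vertex (i + 1)) (vertex (i + 2)) z :=
  (exists_refl i).choose_spec.2.1 z

lemma bary_refl (i j : Fin 3) (z : ℂ) :
    bary j (refl i z) = if j = i then - bary i z else bary j z + bary i z :=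
  (exists_refl i).choose_spec.2.2 j z

/-! ### The table is a fundamental domain -/

/-- Two points are congruent if they are related by the affine Weyl group. -/
def Cong (z z' : ℂ) : Prop := ∃ g ∈ weyl, g z = z'

lemma Cong.refl (z : ℂ) : Cong z z := ⟨1, one_mem _, rfl⟩

lemma Cong.symm {z z' : ℂ} : Cong z z' → Cong z' z := by
  rintro ⟨g, hg, rfl⟩
  exact ⟨g⁻¹, inv_mem hg, isom_inv_apply g z⟩

lemma Cong.trans {z z' z'' : ℂ} : Cong z z' → Cong z' z'' → Cong z z'' := by
  rintro ⟨g, hg, rfl⟩ ⟨h, hh, rfl⟩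
  exact ⟨h * g, mul_mem hh hg, isom_mul_apply h g z⟩

lemma Cong.map {z z' : ℂ} (h : Cong z z') {g : ℂ ≃ᵃⁱ[ℝ] ℂ} (hg : g ∈ extWeyl) :
    Cong (g z) (g z') := by
  obtain ⟨k, hk, rfl⟩ := h
  exact ⟨g * k * g⁻¹, conj_mem_weyl hg hk, by
    rw [isom_mul_apply, isom_mul_apply, isom_inv_apply]⟩

lemma Cong.mem_vertexLattice_iff {z z' : ℂ} (h : Cong z z') :
    z' ∈ vertexLattice ↔ z ∈ vertexLattice := by
  obtain ⟨g, hg, rfl⟩ := h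
  exact extWeyl_apply_mem (weyl_le hg)

lemma mem_table_iff {z : ℂ} : z ∈ table ↔ 0 ≤ cx z ∧ 0 ≤ cy z ∧ cx z + cy z ≤ 1 := by
  rw [mem_table, Fin.forall_fin_succ, Fin.forall_fin_succ, Fin.forall_fin_one]
  simp [bary]
  constructor
  · rintro ⟨h1, h2, h3⟩; exact ⟨h3, h1, by linarith⟩
  · rintro ⟨h1, h2, h3⟩; exact ⟨h2, by linarith, h1⟩

/-- An element of the group that carries a point of the table into the table has a bounded
translation part. This leaves finitely many candidates, each settled by linear inequalities; the
congruence mod 3 rules out the rotations and reflections of the table onto itself. -/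
lemma Cong.eq_of_mem_table {z z' : ℂ} (h : Cong z z') (hz : z ∈ table) (hz' : z' ∈ table) :
    z' = z := by
  obtain ⟨g, hg, rfl⟩ := h
  obtain ⟨m, n, h0, h⟩ := extWeyl_coords (weyl_le hg)
  obtain ⟨m', n', hd, h0'⟩ := hg.2
  have hm : m = m' := by
    have := congrArg cx (h0.symm.trans h0')
    simpa using this
  have hn : n = n' := by
    have := congrArg cy (h0.symm.trans h0')
    simpa using this
  subst hm hn
  obtain ⟨k, hk⟩ := hd
  obtain rfl : m = n + 3 * k := by omega
  rw [mem_table_iff] at hz hz'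
  obtain ⟨a1, a2, a3⟩ := hz
  obtain ⟨b1, b2, b3⟩ := hz'
  have hn1 : (-2 : ℝ) ≤ n ∧ (n : ℝ) ≤ 2 := by
    rcases h with h | h | h | h | h | h <;> obtain ⟨e1, e2⟩ := h z <;> constructor <;> linarith
  have hm1 : (-2 : ℝ) ≤ (n + 3 * k : ℤ) ∧ ((n + 3 * k : ℤ) : ℝ) ≤ 2 := by
    rcases h with h | h | h | h | h | h <;> obtain ⟨e1, e2⟩ := h z <;> constructor <;> linarith
  have c1 : -2 ≤ n := by exact_mod_cast hn1.1
  have c2 : n ≤ 2 := by exact_mod_cast hn1.2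
  have c3 : -2 ≤ n + 3 * k := by exact_mod_cast hm1.1
  have c4 : n + 3 * k ≤ 2 := by exact_mod_cast hm1.2
  have c5 : -1 ≤ k := by omega
  have c6 : k ≤ 1 := by omega
  clear hn1 hm1 h0 h0' hk
  push_cast at h
  apply ext_coords <;> rcases h with h | h | h | h | h | h <;> obtain ⟨e1, e2⟩ := h z <;>
    clear h <;> interval_cases k <;> interval_cases n <;> push_cast at e1 e2 <;> linarith

/-- The rhombus of the lattice that contains `z` is moved onto the table together with its mirror
image in one side `i`. Only the `i`-th coordinate can then be negative, and the sums are the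
coordinates after reflection in that side. The residue of `m - n` mod 3 decides which rotation makes
the motion belong to `weyl`. -/
lemma exists_weyl_rhombus (z : ℂ) : ∃ g ∈ weyl, ∃ i, ∀ j, j ≠ i →
    0 ≤ bary j (g z) ∧ 0 ≤ bary j (g z) + bary i (g z) := by
  set m := ⌊cx z⌋ with hm
  set n := ⌊cy z⌋ with hn
  have h1 := Int.floor_le (cx z)
  have h2 := Int.lt_floor_add_one (cx z)
  have h3 := Int.floor_le (cy z)
  have h4 := Int.lt_floor_add_one (cy z)
  rw [← hm] at h1 h2
  rw [← hn] at h3 h4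
  have hmod : 3 ∣ m - n ∨ 3 ∣ m - n - 1 ∨ 3 ∣ m - n + 1 := by omega
  rcases hmod with h | h | h
  · obtain ⟨g, hg, hgz⟩ := exists_mem_extWeyl_mul (u := 1) (c := (-m : ℤ) + (-n : ℤ) * apex)
      (by simp) ⟨-m, -n, rfl⟩
    have h0 : g 0 ∈ rootLattice := ⟨-m, -n, by omega, by simp [hgz]⟩
    refine ⟨g, ⟨hg, h0⟩, 1, fun j hj => ?_⟩
    have e1 : cx (g z) = cx z - m := by rw [hgz, map_add, cx_int_add_mul]; simp; ring
    have e2 : cy (g z) = cy z - n := by rw [hgz, map_add, cy_int_add_mul]; simp; ring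
    fin_cases j <;> simp [bary, e1, e2] at hj ⊢ <;> constructor <;> linarith
  · obtain ⟨g, hg, hgz⟩ := exists_mem_extWeyl_mul (u := apex - 1)
      (c := (1 + m + n : ℤ) + (-m : ℤ) * apex) apex_sub_one_cube ⟨1 + m + n, -m, rfl⟩
    have h0 : g 0 ∈ rootLattice := ⟨1 + m + n, -m, by omega, by simp [hgz]⟩
    refine ⟨g, ⟨hg, h0⟩, 2, fun j hj => ?_⟩
    have e1 : cx (g z) = - (cx z - m) - (cy z - n) + 1 := by
      rw [hgz, map_add, cx_int_add_mul, sub_one_mul]; simp; ring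
    have e2 : cy (g z) = cx z - m := by
      rw [hgz, map_add, cy_int_add_mul, sub_one_mul]; simp; ring
    fin_cases j <;> simp [bary, e1, e2] at hj ⊢ <;> constructor <;> linarith
  · obtain ⟨g, hg, hgz⟩ := exists_mem_extWeyl_mul (u := -apex)
      (c := (-n : ℤ) + (m + n + 1 : ℤ) * apex) neg_apex_cube ⟨-n, m + n + 1, rfl⟩
    have h0 : g 0 ∈ rootLattice := ⟨-n, m + n + 1, by omega, by simp [hgz]⟩
    refine ⟨g, ⟨hg, h0⟩, 0, fun j hj => ?_⟩
    have e1 : cx (g z) = cy z - n := by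
      rw [hgz, map_add, cx_int_add_mul, neg_mul]; simp; ring
    have e2 : cy (g z) = - (cx z - m) - (cy z - n) + 1 := by
      rw [hgz, map_add, cy_int_add_mul, neg_mul]; simp; ring
    fin_cases j <;> simp [bary, e1, e2] at hj ⊢ <;> constructor <;> linarith

lemma exists_cong_mem_table (z : ℂ) : ∃ z' ∈ table, Cong z z' := by
  obtain ⟨g, hg, i, h⟩ := exists_weyl_rhombus z
  rcases le_total 0 (bary i (g z)) with h0 | h0
  · refine ⟨g z, mem_table.2 fun j => ?_, g, hg, rfl⟩
    by_cases hj : j = i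
    · rwa [hj]
    · exact (h j hj).1
  · refine ⟨refl i (g z), mem_table.2 fun j => ?_, refl i * g, mul_mem (refl_mem i) hg,
      isom_mul_apply _ _ _⟩
    rw [bary_refl]
    split_ifs with hj
    · linarith
    · exact (h j hj).2

/-- The representative of a point in the table. -/
def fold (z : ℂ) : ℂ := (exists_cong_mem_table z).choose

lemma fold_mem (z : ℂ) : fold z ∈ table := (exists_cong_mem_table z).choose_spec.1

lemma cong_fold (z : ℂ) : Cong z (fold z) := (exists_cong_mem_table z).choose_spec.2

lemma Cong.fold_eq {z z' : ℂ} (h : Cong z z') (hz' : z' ∈ table) : fold z = z' :=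
  Cong.eq_of_mem_table (h.symm.trans (cong_fold z)) hz' (fold_mem z)

/-! ### Lines that are pointwise congruent -/

lemma isom_line (g : ℂ ≃ᵃⁱ[ℝ] ℂ) (p w : ℂ) (t : ℝ) :
    g (p + t • w) = g p + t • (g w - g 0) := by
  have h1 : ∀ v q : ℂ, g (v + q) = g.linearIsometryEquiv v + g q := fun v q => g.map_vadd q v
  have h2 : g w - g 0 = g.linearIsometryEquiv w := by
    have := h1 w 0
    rw [add_zero] at this
    rw [this]; ring
  rw [h2, add_comm, h1, map_smul, add_comm]

lemma norm_isom_sub (g : ℂ ≃ᵃⁱ[ℝ] ℂ) (w : ℂ) : ‖g w - g 0‖ = ‖w‖ := by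
  rw [← dist_eq_norm, g.dist_map, dist_zero_right]

lemma countable_vertexLattice : (vertexLattice : Set ℂ).Countable := by
  have : (vertexLattice : Set ℂ) = Set.range fun x : ℤ × ℤ => (x.1 : ℂ) + x.2 * apex := by
    ext z
    simp [mem_vertexLattice, eq_comm]
  rw [this]
  exact Set.countable_range _

lemma countable_weyl : (weyl : Set (ℂ ≃ᵃⁱ[ℝ] ℂ)).Countable := by
  have hU : ({1, apex - 1, -apex} : Set ℂ).Countable := (Set.toFinite _).countable
  have hUV := hU.prod countable_vertexLattice
  have hS := (hUV.image fun x => fun z : ℂ => x.1 * z + x.2).union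
    (hUV.image fun x => fun z : ℂ => x.1 * conj z + x.2)
  refine Set.MapsTo.countable_of_injOn (f := fun g => (g : ℂ → ℂ)) ?_
    (fun _ _ _ _ h => DFunLike.coe_injective h) hS
  intro g hg
  obtain ⟨u, hu, h | h⟩ := extWeyl_form (weyl_le hg)
  · exact Or.inl ⟨(u, g 0), ⟨cube_root_cases hu, hg.1.1⟩, (funext h).symm⟩
  · exact Or.inr ⟨(u, g 0), ⟨cube_root_cases hu, hg.1.1⟩, (funext h).symm⟩

/-- Two lines that are congruent at uncountably many parameters are related by one element of the
affine Weyl group. -/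
lemma exists_weyl_line {p w p' w' : ℂ}
    (h : ¬ {t : ℝ | Cong (p + t • w) (p' + t • w')}.Countable) :
    ∃ g ∈ weyl, ∀ t : ℝ, g (p + t • w) = p' + t • w' := by
  by_contra! hne
  apply h
  have : {t : ℝ | Cong (p + t • w) (p' + t • w')} ⊆
      ⋃ g ∈ (weyl : Set (ℂ ≃ᵃⁱ[ℝ] ℂ)), {t : ℝ | g (p + t • w) = p' + t • w'} := by
    rintro t ⟨g, hg, ht⟩
    exact Set.mem_biUnion hg ht
  -- The group is countable, and an element that matches the two lines at two parameters matches
  -- them everywhere. So if no element matches them everywhere, each accounts for at most one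
  -- parameter.
  refine (countable_weyl.biUnion fun g hg => Set.Subsingleton.countable ?_).mono this
  intro a ha b hb
  by_contra hab
  obtain ⟨t, ht⟩ := hne g hg
  apply ht
  change g (p + a • w) = p' + a • w' at ha
  change g (p + b • w) = p' + b • w' at hb
  rw [isom_line, Complex.real_smul, Complex.real_smul] at ha hb ⊢
  have hab' : (a : ℂ) - b ≠ 0 := by
    rw [sub_ne_zero]; exact_mod_cast hab
  have e1 : g w - g 0 = w' := by
    apply mul_left_cancel₀ hab'
    linear_combination ha - hb
  rw [e1] at ha ⊢
  linear_combination ha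

lemma not_countable_of_nhds {s : Set ℝ} {t : ℝ} (h : s ∈ 𝓝 t) : ¬ s.Countable := by
  obtain ⟨a, b, ht, hs⟩ := mem_nhds_iff_exists_Ioo_subset.1 h
  intro hc
  exact (Cardinal.Real.Ioo_countable_iff.1 (hc.mono hs)).not_gt (ht.1.trans ht.2)

lemma not_countable_of_nhdsGE {s : Set ℝ} {t : ℝ} (h : s ∈ 𝓝[≥] t) : ¬ s.Countable := by
  obtain ⟨u, hu, hs⟩ := mem_nhdsGE_iff_exists_Ico_subset.1 h
  intro hc
  exact (Cardinal.Real.Ioo_countable_iff.1 (hc.mono (Set.Ioo_subset_Ico_self.trans hs))).not_gt hu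

/-! ### Unfolding a trajectory -/

lemma refl_eq_self {i : Fin 3} {z : ℂ} (hz : z ∈ side i) : refl i z = z := by
  rw [mem_side] at hz
  refine Cong.eq_of_mem_table ⟨_, refl_mem i, rfl⟩ hz.1 (mem_table.2 fun j => ?_)
  rw [bary_refl, hz.2]
  split_ifs
  · simp
  · simpa using mem_table.1 hz.1 j

lemma refl_sub_eq_bounce (i : Fin 3) (w : ℂ) : refl i w - refl i 0 = bounce i w := by
  rw [refl_apply, refl_apply, lineReflection, lineReflection, bounce]
  simp only [map_div₀, map_sub, map_zero]
  ring

/-- At a strike the incoming line is simply prolonged: `refl i` fixes the point of impact and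
carries the prolongation to the path after the bounce. -/
lemma IsTrajectory.exists_local_line {α : ℝ → ℂ} (hα : IsTrajectory α) :
    ∃ v : ℝ, 0 < v ∧ ∀ t, ∃ p w : ℂ, ‖w‖ = v ∧ ∀ᶠ r : ℝ in 𝓝 t, Cong (p + r • w) (α r) := by
  obtain ⟨v, hv, h1, h2⟩ := hα.motion
  refine ⟨v, hv, fun t => ?_⟩
  have e : ∀ (r : ℝ) (w : ℂ), α t + (r - t) • w = α t - t • w + r • w := fun r w => by
    rw [sub_smul]; ring
  by_cases ht : α t ∈ bumper
  · obtain ⟨i, hi⟩ := Set.mem_iUnion.1 ht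
    obtain ⟨w, hw, -, hl, hr⟩ := h2 t i hi
    refine ⟨α t - t • w, w, hw, ?_⟩
    rw [← nhdsLE_sup_nhdsGE, Filter.eventually_sup]
    constructor
    · filter_upwards [hl] with r hr
      rw [hr, e]
      exact Cong.refl _
    · filter_upwards [hr] with r hr
      rw [hr, ← e]
      refine ⟨refl i, refl_mem i, ?_⟩
      rw [isom_line, refl_eq_self hi, refl_sub_eq_bounce]
  · obtain ⟨w, hw, h⟩ := h1 t ht
    refine ⟨α t - t • w, w, hw, ?_⟩
    filter_upwards [h] with r hr
    rw [hr, e]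
    exact Cong.refl _

lemma cong_line_of_nhds {α : ℝ → ℂ} {p w p' w' : ℂ} {t : ℝ}
    (h : ∀ᶠ r : ℝ in 𝓝 t, Cong (p + r • w) (α r))
    (h' : ∀ᶠ r : ℝ in 𝓝 t, Cong (p' + r • w') (α r)) (r : ℝ) :
    Cong (p + r • w) (p' + r • w') := by
  have : {r : ℝ | Cong (p + r • w) (p' + r • w')} ∈ 𝓝 t := by
    filter_upwards [h, h'] with r h1 h2 using h1.trans h2.symm
  obtain ⟨g, hg, hgr⟩ := exists_weyl_line (not_countable_of_nhds this)
  exact ⟨g, hg, hgr r⟩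

/-- Every trajectory unfolds to a straight line. -/
lemma IsTrajectory.exists_line {α : ℝ → ℂ} (hα : IsTrajectory α) :
    ∃ p w : ℂ, w ≠ 0 ∧ ∀ t : ℝ, Cong (p + t • w) (α t) := by
  obtain ⟨v, hv, hloc⟩ := hα.exists_local_line
  obtain ⟨p, w, hw, h0⟩ := hloc 0
  refine ⟨p, w, norm_pos_iff.1 (hw ▸ hv), ?_⟩
  -- The times near which the line unfolds the trajectory form a clopen set. At a limit point, the
  -- local line there agrees with the given one up to a single group element.
  set S : Set ℝ := {t | ∀ᶠ r : ℝ in 𝓝 t, Cong (p + r • w) (α r)} with hS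
  have hopen : IsOpen S := isOpen_setOfPred_eventually_nhds
  have hclosed : IsClosed S := by
    refine isClosed_of_closure_subset fun t ht => ?_
    obtain ⟨p', w', -, h'⟩ := hloc t
    obtain ⟨s, hs, hsS⟩ := mem_closure_iff_nhds.1 ht _ (eventually_eventually_nhds.2 h')
    have := cong_line_of_nhds hsS hs
    filter_upwards [h'] with r hr using (this r).trans hr
  have : S = Set.univ := IsClopen.eq_univ ⟨hclosed, hopen⟩ ⟨0, h0⟩
  intro t
  have ht : ∀ᶠ r : ℝ in 𝓝 t, Cong (p + r • w) (α r) := by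
    change t ∈ S
    rw [this]
    exact Set.mem_univ t
  exact ht.self_of_nhds

/-! ### The lines of the tessellation -/

/-- The union of the lines of the tessellation. -/
def OnGrid (z : ℂ) : Prop := ∃ (i : Fin 3) (n : ℤ), bary i z = n

lemma OnGrid.of_coords {z : ℂ} (h : (∃ n : ℤ, cx z = n) ∨ (∃ n : ℤ, cy z = n) ∨
    ∃ n : ℤ, cx z + cy z = n) : OnGrid z := by
  rcases h with ⟨n, h⟩ | ⟨n, h⟩ | ⟨n, h⟩
  · exact ⟨2, n, by simpa [bary] using h⟩
  · exact ⟨0, n, by simpa [bary] using h⟩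
  · exact ⟨1, 1 - n, by simp [bary]; linarith⟩

lemma onGrid_iff_coords {z : ℂ} : OnGrid z ↔ (∃ n : ℤ, cx z = n) ∨ (∃ n : ℤ, cy z = n) ∨
    ∃ n : ℤ, cx z + cy z = n := by
  refine ⟨?_, OnGrid.of_coords⟩
  rintro ⟨i, n, h⟩
  fin_cases i <;> simp [bary] at h
  · exact Or.inr (Or.inl ⟨n, h⟩)
  · exact Or.inr (Or.inr ⟨1 - n, by push_cast; linarith⟩)
  · exact Or.inl ⟨n, h⟩

lemma OnGrid.map {z : ℂ} (hz : OnGrid z) {g : ℂ ≃ᵃⁱ[ℝ] ℂ} (hg : g ∈ extWeyl) :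
    OnGrid (g z) := by
  obtain ⟨m, n, -, h⟩ := extWeyl_coords hg
  rw [onGrid_iff_coords] at hz ⊢
  rcases h with h | h | h | h | h | h <;> obtain ⟨e1, e2⟩ := h z <;> rw [e1, e2] <;>
    rcases hz with ⟨k, hk⟩ | ⟨k, hk⟩ | ⟨k, hk⟩
  · exact Or.inl ⟨k + m, by push_cast; linarith⟩
  · exact Or.inr (Or.inl ⟨k + n, by push_cast; linarith⟩)
  · exact Or.inr (Or.inr ⟨k + m + n, by push_cast; linarith⟩)
  · exact Or.inr (Or.inl ⟨k + n, by push_cast; linarith⟩)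
  · exact Or.inr (Or.inr ⟨- k + m + n, by push_cast; linarith⟩)
  · exact Or.inl ⟨- k + m, by push_cast; linarith⟩
  · exact Or.inr (Or.inr ⟨- k + m + n, by push_cast; linarith⟩)
  · exact Or.inl ⟨k + m, by push_cast; linarith⟩
  · exact Or.inr (Or.inl ⟨- k + n, by push_cast; linarith⟩)
  · exact Or.inr (Or.inr ⟨k + m + n, by push_cast; linarith⟩)
  · exact Or.inr (Or.inl ⟨- k + n, by push_cast; linarith⟩)
  · exact Or.inl ⟨k + m, by push_cast; linarith⟩
  · exact Or.inl ⟨- k + m, by push_cast; linarith⟩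
  · exact Or.inr (Or.inr ⟨k + m + n, by push_cast; linarith⟩)
  · exact Or.inr (Or.inl ⟨k + n, by push_cast; linarith⟩)
  · exact Or.inr (Or.inl ⟨- k + n, by push_cast; linarith⟩)
  · exact Or.inl ⟨- k + m, by push_cast; linarith⟩
  · exact Or.inr (Or.inr ⟨- k + m + n, by push_cast; linarith⟩)

lemma Cong.onGrid_iff {z z' : ℂ} (h : Cong z z') : OnGrid z' ↔ OnGrid z := by
  obtain ⟨g, hg, rfl⟩ := h
  refine ⟨fun h => ?_, fun h => h.map (weyl_le hg)⟩
  have := h.map (weyl_le (inv_mem hg))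
  rwa [isom_inv_apply] at this

lemma mem_bumper_iff_onGrid {z : ℂ} (hz : z ∈ table) : z ∈ bumper ↔ OnGrid z := by
  rw [mem_bumper]
  refine ⟨fun ⟨_, i, hi⟩ => ⟨i, 0, by simpa using hi⟩, fun ⟨i, n, hi⟩ => ⟨hz, ?_⟩⟩
  have h := mem_table.1 hz
  have hs := sum_bary z
  have h0 := h 0
  have h1 := h 1
  have h2 := h 2
  have hn0 : (0 : ℝ) ≤ n := hi ▸ h i
  have hn1 : (n : ℝ) ≤ 1 := by rw [← hi]; fin_cases i <;> simp <;> linarith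
  have hn0' : 0 ≤ n := by exact_mod_cast hn0
  have hn1' : n ≤ 1 := by exact_mod_cast hn1
  obtain rfl | rfl : n = 0 ∨ n = 1 := by omega
  · exact ⟨i, by simpa using hi⟩
  · refine ⟨i + 1, ?_⟩
    fin_cases i <;> simp at hi ⊢ <;> linarith

lemma Cong.mem_bumper_iff {z z' : ℂ} (h : Cong z z') (hz' : z' ∈ table) :
    z' ∈ bumper ↔ OnGrid z := by
  rw [mem_bumper_iff_onGrid hz', h.onGrid_iff]

/-- Barycentric coordinates sum to 1, so two integral ones force the third: grid lines of different
families meet only in vertices. -/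
lemma mem_vertexLattice_of_bary {z : ℂ} {i j : Fin 3} (hij : i ≠ j) {m n : ℤ}
    (hi : bary i z = m) (hj : bary j z = n) : z ∈ vertexLattice := by
  have key : ∀ m n : ℤ, cx z = m → cy z = n → z ∈ vertexLattice := fun m n h1 h2 =>
    ⟨m, n, by rw [eq_cx_add_cy z, h1, h2]; simp⟩
  fin_cases i <;> fin_cases j <;> simp [bary] at hij hi hj
  · exact key (1 - m - n) m (by push_cast; linarith) hi
  · exact key n m hj hi
  · exact key (1 - m - n) n (by push_cast; linarith) hj
  · exact key n (1 - m - n) hj (by push_cast; linarith)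
  · exact key m n hi hj
  · exact key m (1 - m - n) hi (by push_cast; linarith)

lemma vertex_mem_vertexLattice (i : Fin 3) : vertex i ∈ vertexLattice := by
  fin_cases i
  · exact ⟨0, 1, by simp [vertex]⟩
  · exact ⟨0, 0, by simp [vertex]⟩
  · exact ⟨1, 0, by simp [vertex]⟩

lemma exists_vertex_of_mem {z : ℂ} (hz : z ∈ table) (h : z ∈ vertexLattice) :
    ∃ i, z = vertex i := by
  obtain ⟨m, n, rfl⟩ := h
  rw [mem_table_iff, cx_int_add_mul, cy_int_add_mul] at hz
  obtain ⟨h1, h2, h3⟩ := hz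
  have h1 : 0 ≤ m := by exact_mod_cast h1
  have h2 : 0 ≤ n := by exact_mod_cast h2
  have h3 : m + n ≤ 1 := by exact_mod_cast h3
  obtain ⟨rfl, rfl⟩ | ⟨rfl, rfl⟩ | ⟨rfl, rfl⟩ :
    (m = 0 ∧ n = 1) ∨ (m = 0 ∧ n = 0) ∨ (m = 1 ∧ n = 0) := by omega
  · exact ⟨0, by simp [vertex]⟩
  · exact ⟨1, by simp [vertex]⟩
  · exact ⟨2, by simp [vertex]⟩

/-- The line through `p` with direction `w` does not contain a vertex of the tessellation. -/
def Avoids (p w : ℂ) : Prop := ∀ t : ℝ, p + t • w ∉ vertexLattice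

lemma exists_slope_ne_zero {w : ℂ} (hw : w ≠ 0) (i : Fin 3) : ∃ j, j ≠ i ∧ slope j w ≠ 0 := by
  by_contra! h
  apply hw
  apply ext_coords <;> rw [map_zero]
  all_goals
    have h0 := h 0
    have h1 := h 1
    have h2 := h 2
    fin_cases i <;> simp [slope] at h0 h1 h2 <;> linarith

/-- A line running inside a grid line would cross the grid lines of another family, and it would do
so at vertices. -/
lemma Avoids.slope_ne_zero {p w : ℂ} (h : Avoids p w) (hw : w ≠ 0) {i : Fin 3} {n : ℤ}
    {t : ℝ} (hi : bary i (p + t • w) = n) : slope i w ≠ 0 := by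
  intro h0
  obtain ⟨j, hj, hjw⟩ := exists_slope_ne_zero hw i
  apply h (- bary j p / slope j w)
  apply mem_vertexLattice_of_bary hj (m := 0) (n := n)
  · rw [bary_line, div_mul_cancel₀ _ hjw]; simp
  · rw [bary_line, h0] at hi ⊢
    simpa using hi

lemma IsTrajectory.avoids {α : ℝ → ℂ} (hα : IsTrajectory α) {p w : ℂ}
    (h : ∀ t : ℝ, Cong (p + t • w) (α t)) : Avoids p w := by
  intro t ht
  obtain ⟨i, hi⟩ := exists_vertex_of_mem (hα.mem_table t) ((h t).mem_vertexLattice_iff.2 ht)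
  exact hα.ne_vertex t i hi

/-! ### The trajectory that unfolds to a given line -/

lemma line_shift (p w : ℂ) (t r : ℝ) : p + r • w = p + t • w + (r - t) • w := by
  rw [sub_smul]; ring

lemma slope_sub (i : Fin 3) (a b : ℂ) : slope i (a - b) = bary i a - bary i b := by
  fin_cases i <;> simp [slope, bary] ; ring

lemma slope_bounce (i j : Fin 3) (w : ℂ) :
    slope j (bounce i w) = if j = i then - slope i w else slope j w + slope i w := by
  have : ∀ j, slope j w = bary j w - bary j 0 := fun j => by rw [← slope_sub, sub_zero]
  rw [← refl_sub_eq_bounce, slope_sub, bary_refl, bary_refl, this, this]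
  split_ifs <;> ring

lemma norm_bounce (i : Fin 3) (w : ℂ) : ‖bounce i w‖ = ‖w‖ := by
  rw [← refl_sub_eq_bounce, norm_isom_sub]

lemma refl_line {i : Fin 3} {q : ℂ} (hq : q ∈ side i) (w : ℂ) (s : ℝ) :
    refl i (q + s • w) = q + s • bounce i w := by
  rw [isom_line, refl_eq_self hq, refl_sub_eq_bounce]

lemma bary_pos_of_not_mem {q : ℂ} (hq : q ∈ table) (hq' : q ∉ bumper) (j : Fin 3) :
    0 < bary j q := by
  refine lt_of_le_of_ne (mem_table.1 hq j) fun h => hq' ?_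
  rw [mem_bumper]
  exact ⟨hq, j, h.symm⟩

lemma bary_pos_of_mem_side {q : ℂ} {i : Fin 3} (hq : q ∈ side i) (hq' : q ∉ vertexLattice)
    {j : Fin 3} (hj : j ≠ i) : 0 < bary j q := by
  rw [mem_side] at hq
  refine lt_of_le_of_ne (mem_table.1 hq.1 j) fun h => hq' ?_
  exact mem_vertexLattice_of_bary hj (m := 0) (n := 0) (by simpa using h.symm)
    (by simpa using hq.2)

lemma eventually_bary_pos {q w : ℂ} {j : Fin 3} (h : 0 < bary j q) :
    ∀ᶠ s : ℝ in 𝓝 0, 0 < bary j (q + s • w) := by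
  have hc : Continuous fun s : ℝ => bary j (q + s • w) := (continuous_bary j).comp (by fun_prop)
  exact (hc.tendsto 0).eventually_const_lt (by simpa using h)

lemma eventually_fold_eq_of_not_mem {q w : ℂ} (hq : q ∈ table) (hq' : q ∉ bumper) :
    ∀ᶠ s : ℝ in 𝓝 0, fold (q + s • w) = q + s • w := by
  have : ∀ j, ∀ᶠ s : ℝ in 𝓝 0, 0 < bary j (q + s • w) := fun j =>
    eventually_bary_pos (bary_pos_of_not_mem hq hq' j)
  filter_upwards [Filter.eventually_all.2 this] with s hs
  exact (Cong.refl _).fold_eq (mem_table.2 fun j => (hs j).le)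

/-- The negative slope says that the motion is towards the side. Thus the line is in the table just
before the impact, and just after it `refl i` brings it back. The other coordinates stay positive
because `q` is not a vertex. -/
lemma eventually_fold_eq_of_mem_side {q w : ℂ} {i : Fin 3} (hq : q ∈ side i)
    (hq' : q ∉ vertexLattice) (hw : slope i w < 0) :
    (∀ᶠ s : ℝ in 𝓝[≤] 0, fold (q + s • w) = q + s • w) ∧
      ∀ᶠ s : ℝ in 𝓝[≥] 0, fold (q + s • w) = q + s • bounce i w := by
  have hpos : ∀ w' : ℂ, ∀ᶠ s : ℝ in 𝓝 0, ∀ j, j ≠ i → 0 < bary j (q + s • w') := fun w' => by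
    refine Filter.eventually_all.2 fun j => ?_
    by_cases hj : j = i
    · simp [hj]
    · filter_upwards [eventually_bary_pos (w := w') (bary_pos_of_mem_side hq hq' hj)] with s hs _
        using hs
  have h0 := (mem_side.1 hq).2
  constructor
  · filter_upwards [nhdsWithin_le_nhds (hpos w), self_mem_nhdsWithin] with s hs hs0
    refine (Cong.refl _).fold_eq (mem_table.2 fun j => ?_)
    by_cases hj : j = i
    · rw [hj, bary_line, h0, zero_add]
      exact mul_nonneg_of_nonpos_of_nonpos hs0 hw.le
    · exact (hs j hj).le
  · filter_upwards [nhdsWithin_le_nhds (hpos (bounce i w)), self_mem_nhdsWithin] with s hs hs0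
    refine Cong.fold_eq ⟨refl i, refl_mem i, refl_line hq w s⟩ (mem_table.2 fun j => ?_)
    by_cases hj : j = i
    · rw [hj, bary_line, h0, zero_add, slope_bounce, if_pos rfl]
      exact mul_nonneg hs0 (by linarith)
    · exact (hs j hj).le

lemma Cong.fold_congr {z z' : ℂ} (h : Cong z z') : fold z = fold z' :=
  (h.trans (cong_fold z')).fold_eq (fold_mem z')

lemma exists_line_fold (p w : ℂ) (t : ℝ) : ∃ w' : ℂ, ‖w'‖ = ‖w‖ ∧
    ∀ s : ℝ, Cong (p + (t + s) • w) (fold (p + t • w) + s • w') := by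
  obtain ⟨g, hg, hgt⟩ := cong_fold (p + t • w)
  refine ⟨g w - g 0, norm_isom_sub g w, fun s => ⟨g, hg, ?_⟩⟩
  rw [add_smul, ← add_assoc, isom_line, hgt]

lemma tendsto_sub_nhds (t : ℝ) : Filter.Tendsto (fun r : ℝ => r - t) (𝓝 t) (𝓝 0) := by
  have : Continuous fun r : ℝ => r - t := by fun_prop
  simpa using this.tendsto t

/-- The converse of `IsTrajectory.exists_line`. Near each time a group element moves the line to one
through the folded point, so only the local behaviour of `fold` at a point of the table matters. -/
lemma isTrajectory_fold {p w : ℂ} (hw : w ≠ 0) (h : Avoids p w) :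
    IsTrajectory fun t : ℝ => fold (p + t • w) := by
  have hfold : ∀ t : ℝ, fold (p + t • w) ∉ vertexLattice := fun t ht =>
    h t ((cong_fold _).mem_vertexLattice_iff.1 ht)
  have hline : ∀ {t : ℝ} {q w' : ℂ}, (∀ s : ℝ, Cong (p + (t + s) • w) (q + s • w')) →
      ∀ r, fold (p + r • w) = fold (q + (r - t) • w') := fun hc r => by
    rw [← (hc _).fold_congr, add_sub_cancel]
  refine ⟨fun t => fold_mem _, fun t i hi => hfold t (hi ▸ vertex_mem_vertexLattice i),
    ‖w‖, norm_pos_iff.2 hw, fun t ht => ?_, fun t i ht => ?_⟩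
  · obtain ⟨w', hw', hc⟩ := exists_line_fold p w t
    refine ⟨w', hw', ?_⟩
    filter_upwards [(tendsto_sub_nhds t).eventually
      (eventually_fold_eq_of_not_mem (w := w') (fold_mem _) ht)] with r hr
    rw [hline hc, hr]
  · obtain ⟨w', hw', hc, hneg⟩ : ∃ w' : ℂ, ‖w'‖ = ‖w‖ ∧
        (∀ s : ℝ, Cong (p + (t + s) • w) (fold (p + t • w) + s • w')) ∧ slope i w' < 0 := by
      obtain ⟨w', hw', hc⟩ := exists_line_fold p w t
      have hav : Avoids (fold (p + t • w)) w' := fun s hs =>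
        h (t + s) ((hc s).mem_vertexLattice_iff.1 hs)
      have hne : slope i w' ≠ 0 := by
        refine hav.slope_ne_zero (t := 0) (n := 0) ?_ ?_
        · rw [← norm_pos_iff, hw', norm_pos_iff]; exact hw
        · simpa using (mem_side.1 ht).2
      rcases lt_or_gt_of_ne hne with hlt | hlt
      · exact ⟨w', hw', hc, hlt⟩
      -- The group element may have put the incoming half of the line outside the table; the mirror
      -- image in side `i` folds to the same curve and has the right orientation.
      · refine ⟨bounce i w', by rw [norm_bounce, hw'], fun s => (hc s).trans ?_, ?_⟩
        · exact ⟨refl i, refl_mem i, refl_line ht w' s⟩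
        · rw [slope_bounce, if_pos rfl]; linarith
    obtain ⟨hl, hr⟩ := eventually_fold_eq_of_mem_side ht (hfold t) hneg
    have ht0 := tendsto_sub_nhds t
    refine ⟨w', hw', fun hb => ?_, ?_, ?_⟩
    · have := congrArg (slope i) hb
      rw [slope_bounce, if_pos rfl] at this
      linarith
    · have h1 : Filter.Tendsto (fun r : ℝ => r - t) (𝓝[≤] t) (𝓝[≤] 0) :=
        tendsto_nhdsWithin_of_tendsto_nhds_of_eventually_within _
          (ht0.mono_left nhdsWithin_le_nhds)
          (by filter_upwards [self_mem_nhdsWithin] with r hr using sub_nonpos.2 (Set.mem_Iic.1 hr))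
      filter_upwards [h1.eventually hl] with r hr
      rw [hline hc, hr]
    · have h1 : Filter.Tendsto (fun r : ℝ => r - t) (𝓝[≥] t) (𝓝[≥] 0) :=
        tendsto_nhdsWithin_of_tendsto_nhds_of_eventually_within _
          (ht0.mono_left nhdsWithin_le_nhds)
          (by filter_upwards [self_mem_nhdsWithin] with r hr using sub_nonneg.2 (Set.mem_Ici.1 hr))
      filter_upwards [h1.eventually hr] with r hr
      rw [hline hc, hr]

/-! ### Counting the strikes -/

lemma ncard_int_values_of_pos {c k a T : ℝ} {N : ℕ} (hk : 0 < k) (hN : T * k = N) :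
    {t | t ∈ Set.Ico a (a + T) ∧ ∃ n : ℤ, c + t * k = n}.Finite ∧
      {t | t ∈ Set.Ico a (a + T) ∧ ∃ n : ℤ, c + t * k = n}.ncard = N := by
  -- The integers attained are those in the half-open interval from `c + a * k` of length `N`, which
  -- are `N` consecutive ones.
  have key : {t | t ∈ Set.Ico a (a + T) ∧ ∃ n : ℤ, c + t * k = n} =
      (fun n : ℤ => ((n : ℝ) - c) / k) '' (Finset.Ico ⌈c + a * k⌉ (⌈c + a * k⌉ + N) : Finset ℤ) := by
    ext t
    simp only [Set.mem_ofPred_eq, Set.mem_Ico, Set.mem_image, Finset.coe_Ico]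
    constructor
    · rintro ⟨⟨h1, h2⟩, n, hn⟩
      refine ⟨n, ⟨Int.ceil_le.2 ?_, ?_⟩, ?_⟩
      · rw [← hn]; gcongr
      · have h3 : t * k < (a + T) * k := by gcongr
        have : ((n - N : ℤ) : ℝ) < c + a * k := by
          push_cast; rw [← hn, ← hN]; linarith
        have := Int.lt_ceil.2 this
        omega
      · field_simp; linarith
    · rintro ⟨n, ⟨h1, h2⟩, rfl⟩
      have h1 := Int.ceil_le.1 h1
      have h2 : ((n - N : ℤ) : ℝ) < c + a * k := Int.lt_ceil.1 (by omega)
      push_cast at h2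
      rw [← hN] at h2
      refine ⟨⟨?_, ?_⟩, n, by field_simp; ring⟩
      · rw [le_div_iff₀ hk]; linarith
      · rw [div_lt_iff₀ hk]; linarith
  have hinj : Function.Injective fun n : ℤ => ((n : ℝ) - c) / k := fun m n h => by
    have : (m : ℝ) = n := by
      simp only at h
      field_simp at h
      linarith
    exact_mod_cast this
  rw [key]
  refine ⟨(Finset.finite_toSet _).image _, ?_⟩
  rw [Set.ncard_image_of_injective _ hinj, Set.ncard_coe_finset]
  simp

lemma ncard_int_values {c k a T : ℝ} {N : ℤ} (hT : 0 < T) (hN : T * k = N)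
    (hk : k = 0 → ∀ n : ℤ, c ≠ n) :
    {t | t ∈ Set.Ico a (a + T) ∧ ∃ n : ℤ, c + t * k = n}.Finite ∧
      {t | t ∈ Set.Ico a (a + T) ∧ ∃ n : ℤ, c + t * k = n}.ncard = N.natAbs := by
  rcases lt_trichotomy k 0 with h | h | h
  · have hN0 : (N : ℝ) < 0 := by rw [← hN]; exact mul_neg_of_pos_of_neg hT h
    have hN0' : N < 0 := by exact_mod_cast hN0
    have hN' : (N.natAbs : ℝ) = - N := by
      rw [Nat.cast_natAbs, abs_of_neg hN0']; push_cast; rfl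
    have := ncard_int_values_of_pos (c := -c) (k := -k) (a := a) (T := T) (N := N.natAbs)
      (by linarith) (by rw [hN']; linarith)
    have he : ∀ t : ℝ, (∃ n : ℤ, -c + t * -k = n) ↔ ∃ n : ℤ, c + t * k = n := fun t => by
      constructor
      · rintro ⟨n, hn⟩; exact ⟨-n, by push_cast; linarith⟩
      · rintro ⟨n, hn⟩; exact ⟨-n, by push_cast; linarith⟩
    simpa only [he] using this
  · have he : {t | t ∈ Set.Ico a (a + T) ∧ ∃ n : ℤ, c + t * k = n} = ∅ := by
      rw [Set.eq_empty_iff_forall_notMem]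
      rintro t ⟨-, n, hn⟩
      exact hk h n (by rw [← hn, h]; ring)
    have : N = 0 := by
      have : (N : ℝ) = 0 := by rw [← hN, h, mul_zero]
      exact_mod_cast this
    rw [he, this]
    simp
  · have hN0 : 0 < (N : ℝ) := by rw [← hN]; positivity
    have hN0' : 0 < N := by exact_mod_cast hN0
    refine ncard_int_values_of_pos h ?_
    rw [hN, Nat.cast_natAbs, abs_of_pos hN0']

/-- The hexagonal norm, which counts the lines of the tessellation that are crossed. -/
def hexNorm (z : ℂ) : ℝ := |cx z| + |cy z| + |cx z + cy z|

lemma strikes_eq_iUnion (p w : ℂ) (a b : ℝ) :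
    {t | t ∈ Set.Ico a b ∧ OnGrid (p + t • w)} =
      ⋃ i, {t | t ∈ Set.Ico a b ∧ ∃ n : ℤ, bary i p + t * slope i w = n} := by
  ext t
  simp [OnGrid, bary_line, -Complex.real_smul]

/-- The displacement is a lattice vector, so each of the three families of grid lines is crossed an
integral number of times, the absolute value of one coordinate. No crossing is counted twice because
simultaneous crossings happen only at vertices. -/
lemma Avoids.strikes {p w : ℂ} (h : Avoids p w) (hw : w ≠ 0) {T : ℝ} (hT : 0 < T)
    (hTw : T • w ∈ vertexLattice) (a : ℝ) :
    {t | t ∈ Set.Ico a (a + T) ∧ OnGrid (p + t • w)}.Finite ∧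
      ({t | t ∈ Set.Ico a (a + T) ∧ OnGrid (p + t • w)}.ncard : ℝ) = hexNorm (T • w) := by
  obtain ⟨m, n, hmn⟩ := hTw
  have hx : T * cx w = m := by
    have := congrArg cx hmn
    rwa [map_smul, cx_int_add_mul] at this
  have hy : T * cy w = n := by
    have := congrArg cy hmn
    rwa [map_smul, cy_int_add_mul] at this
  have hN : ∀ i, T * slope i w = (![n, -m - n, m] i : ℤ) := fun i => by
    fin_cases i <;> simp [slope] <;> linarith
  have hone := fun i => ncard_int_values (c := bary i p) (k := slope i w) (a := a) hT (hN i)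
    fun hk k hk' => h.slope_ne_zero hw (t := 0) (n := k) (by simpa using hk') hk
  have hdisj : ∀ i j, i ≠ j →
      Disjoint {t | t ∈ Set.Ico a (a + T) ∧ ∃ n : ℤ, bary i p + t * slope i w = n}
        {t | t ∈ Set.Ico a (a + T) ∧ ∃ n : ℤ, bary j p + t * slope j w = n} := fun i j hij => by
    rw [Set.disjoint_left]
    rintro t ⟨-, k, hk⟩ ⟨-, l, hl⟩
    rw [← bary_line] at hk hl
    exact h t (mem_vertexLattice_of_bary hij hk hl)
  rw [strikes_eq_iUnion]
  refine ⟨Set.finite_iUnion fun i => (hone i).1, ?_⟩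
  have hU : (⋃ i, {t | t ∈ Set.Ico a (a + T) ∧ ∃ n : ℤ, bary i p + t * slope i w = n}) =
      {t | t ∈ Set.Ico a (a + T) ∧ ∃ n : ℤ, bary 0 p + t * slope 0 w = n} ∪
      ({t | t ∈ Set.Ico a (a + T) ∧ ∃ n : ℤ, bary 1 p + t * slope 1 w = n} ∪
      {t | t ∈ Set.Ico a (a + T) ∧ ∃ n : ℤ, bary 2 p + t * slope 2 w = n}) := by
    ext t
    simp only [Set.mem_iUnion, Set.mem_union, Fin.exists_fin_succ, Fin.exists_fin_zero]
    simp
  rw [hU, Set.ncard_union_eq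
      (Set.disjoint_union_right.2 ⟨hdisj 0 1 (by decide), hdisj 0 2 (by decide)⟩) (hone 0).1
      ((hone 1).1.union (hone 2).1),
    Set.ncard_union_eq (hdisj 1 2 (by decide)) (hone 1).1 (hone 2).1, (hone 0).2, (hone 1).2,
    (hone 2).2, hexNorm, hmn, cx_int_add_mul, cy_int_add_mul]
  push_cast
  simp only [Nat.cast_natAbs]
  push_cast
  rw [show (-m - n : ℝ) = -(m + n) by ring, abs_neg]
  ring

/-- For a glide reflection the displacement of one run need not be a lattice vector, while that of
two runs always is. Strikes are therefore counted over two runs and halved. -/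
lemma ncard_two_mul {P : ℝ → Prop} {T : ℝ} (hP : ∀ t, P (t + T) ↔ P t) (hT : 0 < T) (a : ℝ)
    (hfin : {t | t ∈ Set.Ico a (a + 2 * T) ∧ P t}.Finite) :
    {t | t ∈ Set.Ico a (a + 2 * T) ∧ P t}.ncard = 2 * {t | t ∈ Set.Ico a (a + T) ∧ P t}.ncard := by
  have h1 : {t | t ∈ Set.Ico a (a + 2 * T) ∧ P t} = {t | t ∈ Set.Ico a (a + T) ∧ P t} ∪
      (fun t => t + T) '' {t | t ∈ Set.Ico a (a + T) ∧ P t} := by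
    ext t
    simp only [Set.mem_ofPred_eq, Set.mem_union, Set.mem_image, Set.mem_Ico]
    constructor
    · rintro ⟨⟨h1, h2⟩, h3⟩
      rcases lt_or_ge t (a + T) with h | h
      · exact Or.inl ⟨⟨h1, h⟩, h3⟩
      · refine Or.inr ⟨t - T, ⟨⟨by linarith, by linarith⟩, ?_⟩, by ring⟩
        rw [← hP]; simpa using h3
    · rintro (⟨⟨h1, h2⟩, h3⟩ | ⟨s, ⟨⟨h1, h2⟩, h3⟩, rfl⟩)
      · exact ⟨⟨h1, by linarith⟩, h3⟩
      · exact ⟨⟨by linarith, by linarith⟩, (hP s).2 h3⟩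
  have hd : Disjoint {t | t ∈ Set.Ico a (a + T) ∧ P t}
      ((fun t => t + T) '' {t | t ∈ Set.Ico a (a + T) ∧ P t}) := by
    rw [Set.disjoint_left]
    rintro t ⟨⟨h1, h2⟩, -⟩ ⟨s, ⟨⟨h3, h4⟩, -⟩, rfl⟩
    simp only at h2
    linarith
  rw [h1] at hfin ⊢
  rw [Set.ncard_union_eq hd (hfin.subset Set.subset_union_left)
    (hfin.subset Set.subset_union_right),
    Set.ncard_image_of_injective _ (add_left_injective T)]
  ring

lemma hexNorm_smul (r : ℝ) (z : ℂ) : hexNorm (r • z) = |r| * hexNorm z := by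
  simp only [hexNorm, map_smul, smul_eq_mul, ← mul_add, abs_mul]

/-! ### The translation of a periodic line -/

/-- A single group element induces the shift by `T` along the line, so its linear part fixes `w`. A
rotation that does so is trivial and the element is a translation; otherwise it is a reflection or
glide reflection, whose square is the translation by `(2 * T) • w`. -/
lemma exists_translation {p w : ℂ} {T : ℝ} (hw : w ≠ 0)
    (h : ∀ t : ℝ, Cong (p + t • w) (p + (t + T) • w)) :
    T • w ∈ rootLattice ∨ (2 * T) • w ∈ rootLattice ∧ ∃ u : ℂ, u ^ 3 = 1 ∧ w = u * conj w := by
  have hc : ¬ {t : ℝ | Cong (p + t • w) ((p + T • w) + t • w)}.Countable := by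
    have : {t : ℝ | Cong (p + t • w) ((p + T • w) + t • w)} = Set.univ := by
      ext t
      have := h t
      rw [add_smul, add_comm (t • w), ← add_assoc] at this
      simpa using this
    rw [this]
    exact Cardinal.not_countable_real
  obtain ⟨g, hg, hgt⟩ := exists_weyl_line hc
  have hg0 : g p = p + T • w := by simpa using hgt 0
  have hgw : g w - g 0 = w := by
    have h1 := hgt 1
    rw [isom_line, hg0] at h1
    simpa using h1
  obtain ⟨u, hu, hf | hf⟩ := extWeyl_form (weyl_le hg)
  · left
    rw [hf w] at hgw
    have hu1 : u = 1 := by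
      apply mul_right_cancel₀ hw
      linear_combination hgw
    have : T • w = g 0 := by
      rw [hf, hu1] at hg0
      linear_combination - hg0
    rw [this]
    exact hg.2
  · right
    rw [hf w] at hgw
    have hgw' : w = u * conj w := by linear_combination - hgw
    refine ⟨?_, u, hu, hgw'⟩
    have h2 : g (g p) = p + (2 * T) • w := by
      have := hgt T
      rw [← hg0] at this
      rw [this, hg0, two_mul, add_smul, add_assoc]
    have h3 : (2 * T) • w = (g * g) 0 := by
      rw [isom_mul_apply]
      rw [hf (g p), hf p, map_add, map_mul, conj_cube_root hu, Complex.conj_conj] at h2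
      rw [hf (g 0)]
      linear_combination p * hu - h2
    rw [h3]
    exact (mul_mem hg hg).2

lemma PeriodicOrbit.duration_pos (α : PeriodicOrbit) : 0 < α.duration :=
  sub_pos.2 α.initial_lt_final

lemma PeriodicOrbit.traj_add_duration (α : PeriodicOrbit) (t : ℝ) :
    α.traj (t + α.duration) = α.traj t := by
  have := α.periodic (t - α.initial)
  rw [add_sub_cancel] at this
  rw [this, duration]
  ring_nf

lemma PeriodicOrbit.cong_line (α : PeriodicOrbit) {p w : ℂ}
    (h : ∀ t : ℝ, Cong (p + t • w) (α.traj t)) (t : ℝ) :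
    Cong (p + t • w) (p + (t + α.duration) • w) := by
  have := h (t + α.duration)
  rw [α.traj_add_duration] at this
  exact (h t).trans this.symm

/-- The period of an orbit is the hexagonal norm of the displacement along the unfolded line. -/
lemma PeriodicOrbit.period_eq (α : PeriodicOrbit) {p w : ℂ} (hw : w ≠ 0)
    (h : ∀ t : ℝ, Cong (p + t • w) (α.traj t)) :
    (α.period : ℝ) = hexNorm (α.duration • w) := by
  have hT := α.duration_pos
  have hav := α.isTrajectory.avoids h
  have h2 : (2 * α.duration) • w ∈ rootLattice := by
    rcases exists_translation hw (α.cong_line h) with h1 | h1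
    · rw [two_mul, add_smul]; exact rootLattice.add_mem h1 h1
    · exact h1.1
  obtain ⟨hfin, hcard⟩ := hav.strikes hw (by positivity) (rootLattice_le h2) α.initial
  have hP : ∀ t : ℝ, OnGrid (p + (t + α.duration) • w) ↔ OnGrid (p + t • w) := fun t =>
    (α.cong_line h t).onGrid_iff
  rw [ncard_two_mul hP hT _ hfin, mul_smul, hexNorm_smul] at hcard
  have hper : α.period =
      {t | t ∈ Set.Ico α.initial (α.initial + α.duration) ∧ OnGrid (p + t • w)}.ncard := by
    rw [period, duration, add_sub_cancel]
    congr 1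
    ext t
    simp only [Set.mem_ofPred_eq, (h t).mem_bumper_iff (α.isTrajectory.mem_table t)]
  rw [hper]
  push_cast at hcard
  rw [abs_of_pos (by norm_num : (0 : ℝ) < 2)] at hcard
  linarith

/-! ### The cone of inclinations between 30 and 60 degrees -/

/-- The vectors of inclination between 30 and 60 degrees, in rhombic coordinates. -/
def InCone (w : ℂ) : Prop := 0 ≤ cx w ∧ cx w ≤ cy w

lemma InCone.cy_pos {w : ℂ} (h : InCone w) (hw : w ≠ 0) : 0 < cy w := by
  refine lt_of_le_of_ne (h.1.trans h.2) fun h0 => hw ?_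
  apply ext_coords
  · rw [map_zero]; exact le_antisymm (h.2.trans h0.symm.le) h.1
  · rw [map_zero, h0]

/-- The two forms defining the cone vanish in the directions of 60 and 30 degrees, so their signs
are those of sines of angle differences. -/
lemma coords_eq_sin (w : ℂ) : cx w = 2 / √3 * ‖w‖ * Real.sin (Real.pi / 3 - w.arg) ∧
    cy w - cx w = 2 * ‖w‖ * Real.sin (w.arg - Real.pi / 6) := by
  have h3 := sqrt_three_pos
  have hs := sqrt_three_mul_self
  have hre := Complex.norm_mul_cos_arg w
  have him := Complex.norm_mul_sin_arg w
  rw [Real.sin_sub, Real.sin_sub, Real.sin_pi_div_three, Real.cos_pi_div_three,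
    Real.sin_pi_div_six, Real.cos_pi_div_six]
  have e1 : cx w = ‖w‖ * Real.cos w.arg - ‖w‖ * Real.sin w.arg / √3 := by
    rw [hre, him, cx_def]
  have e2 : cy w = 2 * (‖w‖ * Real.sin w.arg) / √3 := by
    rw [him, cy_def]
  rw [e2, e1]
  constructor
  · field_simp
  · field_simp
    linear_combination - ‖w‖ * Real.sin w.arg * hs

lemma inCone_of_arg {w : ℂ} (h1 : Real.pi / 6 ≤ w.arg) (h2 : w.arg ≤ Real.pi / 3) :
    w ≠ 0 ∧ InCone w := by
  have hpi := Real.pi_pos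
  refine ⟨?_, ?_, ?_⟩
  · rintro rfl
    rw [Complex.arg_zero] at h1
    linarith
  · rw [(coords_eq_sin w).1]
    have := Real.sin_nonneg_of_nonneg_of_le_pi (x := Real.pi / 3 - w.arg) (by linarith)
      (by linarith)
    positivity
  · rw [← sub_nonneg, (coords_eq_sin w).2]
    have := Real.sin_nonneg_of_nonneg_of_le_pi (x := w.arg - Real.pi / 6) (by linarith)
      (by linarith)
    positivity

lemma InCone.arg {w : ℂ} (h : InCone w) (hw : w ≠ 0) :
    Real.pi / 6 ≤ w.arg ∧ w.arg ≤ Real.pi / 3 := by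
  have hpi := Real.pi_pos
  have hn : 0 < ‖w‖ := norm_pos_iff.2 hw
  have him : 0 < w.im := by
    have := h.cy_pos hw
    rw [cy_def] at this
    have h3 := sqrt_three_pos
    have h4 := (div_pos_iff_of_pos_right h3).1 this
    linarith
  have ha := Complex.arg_le_pi w
  have ha0 : 0 ≤ w.arg := Complex.arg_nonneg_iff.2 him.le
  have hc1 := h.1
  have hc2 := sub_nonneg.2 h.2
  rw [(coords_eq_sin w).1] at hc1
  rw [(coords_eq_sin w).2] at hc2
  constructor
  · by_contra! hlt
    have := Real.sin_neg_of_neg_of_neg_pi_lt (x := w.arg - Real.pi / 6) (by linarith)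
      (by linarith)
    have := mul_neg_of_pos_of_neg (by positivity : 0 < 2 * ‖w‖) this
    linarith
  · by_contra! hlt
    have := Real.sin_neg_of_neg_of_neg_pi_lt (x := Real.pi / 3 - w.arg) (by linarith)
      (by linarith)
    have := mul_neg_of_pos_of_neg (by positivity : 0 < 2 / √3 * ‖w‖) this
    linarith

/-! ### Directions up to the symmetries of the tessellation -/

/-- Two vectors are related by the linear part of a symmetry of the tessellation. -/
def SymRel (w v : ℂ) : Prop :=
  ∃ g ∈ extWeyl, ∃ ε : ℝ, (ε = 1 ∨ ε = -1) ∧ v = ε • (g w - g 0)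

lemma isom_smul_sub (g : ℂ ≃ᵃⁱ[ℝ] ℂ) (ε : ℝ) (w : ℂ) : g (ε • w) - g 0 = ε • (g w - g 0) := by
  have := isom_line g 0 w ε
  rw [zero_add] at this
  rw [this]; ring

lemma SymRel.symm {w v : ℂ} : SymRel w v → SymRel v w := by
  rintro ⟨g, hg, ε, hε, rfl⟩
  refine ⟨g⁻¹, inv_mem hg, ε, hε, ?_⟩
  have h1 : ε * ε = 1 := by rcases hε with rfl | rfl <;> norm_num
  have h2 : g⁻¹ (g w) = g⁻¹ (g 0) + (1 : ℝ) • (g⁻¹ (g w - g 0) - g⁻¹ 0) := by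
    rw [← isom_line]; simp
  rw [isom_inv_apply, isom_inv_apply] at h2
  rw [zero_add, one_smul] at h2
  rw [isom_smul_sub, smul_smul, h1, one_smul]
  exact h2

lemma SymRel.trans {w v u : ℂ} : SymRel w v → SymRel v u → SymRel w u := by
  rintro ⟨g, hg, ε, hε, rfl⟩ ⟨h, hh, δ, hδ, rfl⟩
  refine ⟨h * g, mul_mem hh hg, δ * ε, ?_, ?_⟩
  · rcases hε with rfl | rfl <;> rcases hδ with rfl | rfl <;> norm_num
  · have h2 : h (g w) = h (g 0) + (1 : ℝ) • (h (g w - g 0) - h 0) := by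
      rw [← isom_line]; simp
    rw [isom_mul_apply, isom_mul_apply, isom_smul_sub, smul_smul, h2]
    simp

lemma SymRel.coords {w v : ℂ} (h : SymRel w v) : ∃ ε : ℝ, (ε = 1 ∨ ε = -1) ∧
    ((cx v = ε * cx w ∧ cy v = ε * cy w) ∨
     (cx v = ε * (- cx w - cy w) ∧ cy v = ε * cx w) ∨
     (cx v = ε * cy w ∧ cy v = ε * (- cx w - cy w)) ∨
     (cx v = ε * (cx w + cy w) ∧ cy v = ε * (- cy w)) ∨
     (cx v = ε * (- cx w) ∧ cy v = ε * (cx w + cy w)) ∨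
     (cx v = ε * (- cy w) ∧ cy v = ε * (- cx w))) := by
  obtain ⟨g, hg, ε, hε, rfl⟩ := h
  refine ⟨ε, hε, ?_⟩
  obtain ⟨m, n, -, h⟩ := extWeyl_coords hg
  simp only [map_smul, map_sub, smul_eq_mul]
  rcases h with h | h | h | h | h | h <;> obtain ⟨e1, e2⟩ := h w <;> obtain ⟨e3, e4⟩ := h 0 <;>
    rw [e1, e2, e3, e4] <;> simp only [map_zero] <;> ring_nf <;> simp

/-- Symmetries permute the three families of grid lines, and with them the three summands. -/
lemma SymRel.hexNorm_eq {w v : ℂ} (h : SymRel w v) : hexNorm v = hexNorm w := by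
  obtain ⟨ε, hε, h⟩ := h.coords
  have ha : |ε| = 1 := by rcases hε with rfl | rfl <;> simp
  unfold hexNorm
  rcases h with h | h | h | h | h | h <;> rw [h.1, h.2, ← mul_add, abs_mul, abs_mul, abs_mul, ha]
  · ring
  · rw [show - cx w - cy w + cx w = - cy w by ring, show - cx w - cy w = -(cx w + cy w) by ring,
      abs_neg, abs_neg]; ring
  · rw [show cy w + (- cx w - cy w) = - cx w by ring,
      show - cx w - cy w = -(cx w + cy w) by ring, abs_neg, abs_neg]; ring
  · rw [show cx w + cy w + - cy w = cx w by ring, abs_neg]; ring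
  · rw [show - cx w + (cx w + cy w) = cy w by ring, abs_neg]; ring
  · rw [show - cy w + - cx w = -(cx w + cy w) by ring, abs_neg, abs_neg, abs_neg]; ring

/-- With signs there are 12 linear parts, and the cone is one of the 12 chambers of 30 degrees that
they permute simply transitively. -/
lemma SymRel.eq_of_inCone {w v : ℂ} (h : SymRel w v) (hw : InCone w) (hv : InCone v) : v = w := by
  obtain ⟨ε, hε, h⟩ := h.coords
  obtain ⟨h1, h2⟩ := hw
  obtain ⟨h3, h4⟩ := hv
  apply ext_coords <;> rcases hε with rfl | rfl <;> rcases h with h | h | h | h | h | h <;>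
    obtain ⟨e1, e2⟩ := h <;> linarith

lemma exists_inCone (w : ℂ) : ∃ v, SymRel w v ∧ InCone v := by
  have key : ∀ (u : ℂ) (ε : ℝ), u ^ 3 = 1 → (ε = 1 ∨ ε = -1) →
      SymRel w (ε • (u * w)) ∧ SymRel w (ε • (u * conj w)) := fun u ε hu hε => by
    constructor
    · obtain ⟨g, hg, h⟩ := exists_mem_extWeyl_mul hu vertexLattice.zero_mem
      exact ⟨g, hg, ε, hε, by simp [h]⟩
    · obtain ⟨g, hg, h⟩ := exists_mem_extWeyl_mul_conj hu vertexLattice.zero_mem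
      exact ⟨g, hg, ε, hε, by simp [h]⟩
  by_contra! hne
  have h1 : ∀ ε : ℝ, (ε = 1 ∨ ε = -1) → _ := fun ε hε => hne _ (key 1 ε (by simp) hε).1
  have h2 : ∀ ε : ℝ, (ε = 1 ∨ ε = -1) → _ := fun ε hε => hne _ (key _ ε apex_sub_one_cube hε).1
  have h3 : ∀ ε : ℝ, (ε = 1 ∨ ε = -1) → _ := fun ε hε => hne _ (key _ ε neg_apex_cube hε).1
  have h4 : ∀ ε : ℝ, (ε = 1 ∨ ε = -1) → _ := fun ε hε => hne _ (key 1 ε (by simp) hε).2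
  have h5 : ∀ ε : ℝ, (ε = 1 ∨ ε = -1) → _ := fun ε hε => hne _ (key _ ε apex_sub_one_cube hε).2
  have h6 : ∀ ε : ℝ, (ε = 1 ∨ ε = -1) → _ := fun ε hε => hne _ (key _ ε neg_apex_cube hε).2
  simp only [InCone, map_smul, smul_eq_mul, one_mul, neg_mul, sub_one_mul, map_sub, map_neg,
    cx_apex_mul, cy_apex_mul, cx_conj, cy_conj, not_and_or, not_le, forall_eq_or_imp,
    forall_eq] at h1 h2 h3 h4 h5 h6
  -- These six linear forms are the walls of the twelve chambers. Their signs locate `w`, and one of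
  -- the twelve images is then visibly in the cone.
  rcases le_total 0 (cx w) with hx | hx <;> rcases le_total 0 (cy w) with hy | hy <;>
    rcases le_total 0 (cx w + cy w) with hxy | hxy <;>
    rcases le_total (cx w) (cy w) with hd | hd <;>
    rcases le_total 0 (2 * cx w + cy w) with he | he <;>
    rcases le_total 0 (cx w + 2 * cy w) with hf | hf <;>
    first
    | (rcases h1.1 with h | h <;> linarith)
    | (rcases h1.2 with h | h <;> linarith)
    | (rcases h2.1 with h | h <;> linarith)
    | (rcases h2.2 with h | h <;> linarith)
    | (rcases h3.1 with h | h <;> linarith)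
    | (rcases h3.2 with h | h <;> linarith)
    | (rcases h4.1 with h | h <;> linarith)
    | (rcases h4.2 with h | h <;> linarith)
    | (rcases h5.1 with h | h <;> linarith)
    | (rcases h5.2 with h | h <;> linarith)
    | (rcases h6.1 with h | h <;> linarith)
    | (rcases h6.2 with h | h <;> linarith)

/-! ### Relabelling the vertices -/

/-- Needed because transpositions of the vertices act on the triangle as the negative of an element
of `extWeyl`; the map `z ↦ -z` normalizes `weyl`. -/
lemma Cong.neg {z z' : ℂ} (h : Cong z z') : Cong (-z) (-z') := by
  obtain ⟨g, hg, rfl⟩ := h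
  have hL := rootLattice.neg_mem hg.2
  obtain ⟨u, hu, h | h⟩ := extWeyl_form hg.1
  · obtain ⟨k, hk, hkz⟩ := exists_mem_extWeyl_mul hu (rootLattice_le hL)
    exact ⟨k, ⟨hk, by simpa [hkz] using hL⟩, by rw [hkz, h z]; ring⟩
  · obtain ⟨k, hk, hkz⟩ := exists_mem_extWeyl_mul_conj hu (rootLattice_le hL)
    exact ⟨k, ⟨hk, by simpa [hkz] using hL⟩, by rw [hkz, h z, map_neg]; ring⟩

lemma isom_apply_coords (g : ℂ ≃ᵃⁱ[ℝ] ℂ) (z : ℂ) :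
    g z = g (vertex 1) + cx z * (g (vertex 2) - g (vertex 1)) +
      cy z * (g (vertex 0) - g (vertex 1)) := by
  have hz : (0 : ℂ) + cx z • (1 : ℂ) + cy z • apex = z := by
    conv_rhs => rw [eq_cx_add_cy z]
    simp
  conv_lhs => rw [← hz]
  rw [isom_line, isom_line]
  simp [vertex]

/-- The symmetries of the table, up to sign, belong to `extWeyl`. -/
lemma exists_extWeyl_of_vertex {g : ℂ ≃ᵃⁱ[ℝ] ℂ} {π : Equiv.Perm (Fin 3)}
    (h : ∀ i, g (vertex i) = vertex (π i)) :
    ∃ k ∈ extWeyl, ∃ δ : ℝ, (δ = 1 ∨ δ = -1) ∧ ∀ z, g z = δ • k z := by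
  have h01 : π 0 ≠ π 1 := π.injective.ne (by decide)
  have h02 : π 0 ≠ π 2 := π.injective.ne (by decide)
  have h12 : π 1 ≠ π 2 := π.injective.ne (by decide)
  have hf := isom_apply_coords g
  rw [h 0, h 1, h 2] at hf
  have keyp : ∀ u c : ℂ, u ^ 3 = 1 → c ∈ vertexLattice → (∀ z, g z = u * z + c) →
      ∃ k ∈ extWeyl, ∃ δ : ℝ, (δ = 1 ∨ δ = -1) ∧ ∀ z, g z = δ • k z := fun u c hu hc hz => by
    obtain ⟨k, hk, hkz⟩ := exists_mem_extWeyl_mul hu hc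
    exact ⟨k, hk, 1, Or.inl rfl, fun z => by rw [hkz, hz, one_smul]⟩
  have keyn : ∀ u c : ℂ, u ^ 3 = 1 → c ∈ vertexLattice → (∀ z, g z = -(u * conj z + c)) →
      ∃ k ∈ extWeyl, ∃ δ : ℝ, (δ = 1 ∨ δ = -1) ∧ ∀ z, g z = δ • k z := fun u c hu hc hz => by
    obtain ⟨k, hk, hkz⟩ := exists_mem_extWeyl_mul_conj hu hc
    exact ⟨k, hk, -1, Or.inr rfl, fun z => by rw [hkz, hz]; simp; ring⟩
  have hv := vertex_mem_vertexLattice (π 1)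
  have hz : ∀ z, z = cx z + cy z * apex := eq_cx_add_cy
  have hzc : ∀ z, conj z = cx z + cy z * (1 - apex) := fun z => by
    conv_lhs => rw [hz z]
    simp [conj_apex]
  generalize π 0 = a at *
  generalize π 1 = b at *
  generalize π 2 = c at *
  fin_cases a <;> fin_cases b <;> fin_cases c <;> simp at h01 h02 h12
  all_goals simp [vertex] at hf hv
  · refine keyp 1 0 (by simp) vertexLattice.zero_mem fun z => ?_
    rw [hf]; conv_rhs => rw [hz z]
    ring
  · refine keyn 1 (-1) (by simp) (vertexLattice.neg_mem hv) fun z => ?_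
    rw [hf, hzc]; ring
  · refine keyn (apex - 1) (-apex) apex_sub_one_cube (vertexLattice.neg_mem hv) fun z => ?_
    rw [hf, hzc]; linear_combination - (cy z : ℂ) * apex_sq
  · refine keyp (apex - 1) 1 apex_sub_one_cube hv fun z => ?_
    rw [hf]; conv_rhs => rw [hz z]
    linear_combination -(cy z : ℂ) * apex_sq
  · refine keyp (-apex) apex neg_apex_cube hv fun z => ?_
    rw [hf]; conv_rhs => rw [hz z]
    linear_combination (cy z : ℂ) * apex_sq
  · refine keyn (-apex) 0 neg_apex_cube vertexLattice.zero_mem fun z => ?_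
    rw [hf, hzc]; linear_combination (cy z : ℂ) * apex_sq

lemma table_of_vertex {g : ℂ ≃ᵃⁱ[ℝ] ℂ} {π : Equiv.Perm (Fin 3)}
    (h : ∀ i, g (vertex i) = vertex (π i)) {z : ℂ} (hz : z ∈ table) : g z ∈ table := by
  have h1 : g z ∈ g.toAffineEquiv.toAffineMap '' convexHull ℝ (Set.range vertex) := ⟨z, hz, rfl⟩
  rw [AffineMap.image_convexHull] at h1
  refine convexHull_mono ?_ h1
  rintro _ ⟨_, ⟨i, rfl⟩, rfl⟩
  exact ⟨π i, (h i).symm⟩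

/-- A presentation of an orbit unfolds to a line. -/
lemma PeriodicOrbit.IsPresentation.exists_line {α : PeriodicOrbit} {β : ℝ → ℂ}
    (hβ : α.IsPresentation β) {p w : ℂ} (h : ∀ t : ℝ, Cong (p + t • w) (α.traj t)) :
    ∃ q v : ℂ, SymRel w v ∧ Avoids q v ∧ ∀ t : ℝ, Cong (q + t • v) (β t) := by
  obtain ⟨π, g, c, ε, hg, hε, hβ⟩ := hβ
  obtain ⟨k, hk, δ, hδ, hgk⟩ := exists_extWeyl_of_vertex hg
  have hmap : ∀ {z z' : ℂ}, Cong z z' → Cong (g z) (g z') := fun hc => by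
    rw [hgk, hgk]
    rcases hδ with rfl | rfl
    · simpa using hc.map hk
    · simpa using (hc.map hk).neg
  have hlat : ∀ {z : ℂ}, g z ∈ vertexLattice → z ∈ vertexLattice := fun {z} hz => by
    rw [hgk] at hz
    rw [← extWeyl_apply_mem hk]
    rcases hδ with rfl | rfl
    · simpa using hz
    · simpa using hz
  have hl : ∀ t : ℝ, g (p + (c + ε * t) • w) = g (p + c • w) + t • ((δ * ε) • (k w - k 0)) := by
    intro t
    rw [add_smul, ← add_assoc, isom_line, hgk w, hgk 0, ← smul_sub, smul_smul, smul_smul]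
    ring_nf
  refine ⟨g (p + c • w), (δ * ε) • (k w - k 0), ⟨k, hk, δ * ε, ?_, rfl⟩, fun t ht => ?_,
    fun t => ?_⟩
  · rcases hε with rfl | rfl <;> rcases hδ with rfl | rfl <;> norm_num
  · rw [← hl] at ht
    exact α.isTrajectory.avoids h _ (hlat ht)
  · rw [← hl, hβ]
    exact hmap (h _)

lemma PeriodicOrbit.IsPresentation.mem_table {α : PeriodicOrbit} {β : ℝ → ℂ}
    (hβ : α.IsPresentation β) (t : ℝ) : β t ∈ table := by
  obtain ⟨π, g, c, ε, hg, hε, hβ⟩ := hβ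
  rw [hβ]
  exact table_of_vertex hg (α.isTrajectory.mem_table _)

lemma PeriodicOrbit.IsPresentation.add_duration {α : PeriodicOrbit} {β : ℝ → ℂ}
    (hβ : α.IsPresentation β) (t : ℝ) : β (t + α.duration) = β t := by
  obtain ⟨π, g, c, ε, hg, rfl | rfl, hβ⟩ := hβ
  · rw [hβ, hβ, ← α.traj_add_duration (c + 1 * t)]
    ring_nf
  · rw [hβ, hβ, ← α.traj_add_duration (c + -1 * (t + α.duration))]
    ring_nf

/-! ### The unfolding process -/

/-- The composition of reflections `unfoldMap s k`, as an isometry. -/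
def unfoldIsom (s : ℕ → Fin 3) : ℕ → ℂ ≃ᵃⁱ[ℝ] ℂ
  | 0 => 1
  | k + 1 => unfoldIsom s k * refl (s k)

lemma unfoldIsom_mem (s : ℕ → Fin 3) (k : ℕ) : unfoldIsom s k ∈ weyl := by
  induction k with
  | zero => exact one_mem _
  | succ k ih => exact mul_mem ih (refl_mem _)

/-- Conjugating a reflection by `g` moves its mirror by `g`. Hence composing on the left with
reflections in the moved sides, as in `unfoldMap`, is multiplying on the right by reflections in the
fixed sides, as in `unfoldIsom`. -/
lemma lineReflection_map {g : ℂ ≃ᵃⁱ[ℝ] ℂ} (hg : g ∈ extWeyl) (p q z : ℂ) :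
    lineReflection (g p) (g q) (g z) = g (lineReflection p q z) := by
  obtain ⟨u, hu, h | h⟩ := extWeyl_form hg
  · have hu0 : u ≠ 0 := by rintro rfl; norm_num at hu
    have e : (g z - g p) / (g q - g p) = (z - p) / (q - p) := by
      rw [h z, h p, h q, ← mul_div_mul_left (z - p) (q - p) hu0]
      ring_nf
    rw [lineReflection, e, lineReflection, h (p + _), h p, h q]
    ring
  · have hu0 : u ≠ 0 := by rintro rfl; norm_num at hu
    have e : (g z - g p) / (g q - g p) = conj ((z - p) / (q - p)) := by
      rw [h z, h p, h q, map_div₀, map_sub, map_sub,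
        ← mul_div_mul_left (conj z - conj p) (conj q - conj p) hu0]
      congr 1 <;> ring
    rw [lineReflection, e, lineReflection, h (p + _), h p, h q, map_add, map_mul, map_sub]
    ring

lemma unfoldMap_eq (s : ℕ → Fin 3) (k : ℕ) (z : ℂ) : unfoldMap s k z = unfoldIsom s k z := by
  induction k generalizing z with
  | zero => rfl
  | succ k ih =>
    rw [unfoldMap, Function.comp_apply, ih, ih, ih,
      lineReflection_map (weyl_le (unfoldIsom_mem s k)), unfoldIsom, isom_mul_apply, refl_apply]

lemma refl_refl (i : Fin 3) (z : ℂ) : refl i (refl i z) = z := by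
  have : ∀ j, bary j (refl i (refl i z)) = bary j z := fun j => by
    rw [bary_refl, bary_refl, bary_refl]
    split_ifs <;> simp_all
  rw [eq_sum_bary (refl i (refl i z)), this, this, this, ← eq_sum_bary]

lemma refl_inv_apply (i : Fin 3) (z : ℂ) : (refl i)⁻¹ z = refl i z := by
  conv_lhs => rw [← refl_refl i z]
  exact isom_inv_apply _ _

lemma unfoldIsom_succ_inv_apply (s : ℕ → Fin 3) (k : ℕ) (z : ℂ) :
    (unfoldIsom s (k + 1))⁻¹ z = refl (s k) ((unfoldIsom s k)⁻¹ z) := by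
  rw [unfoldIsom, mul_inv_rev, isom_mul_apply, refl_inv_apply]

/-- A line that enters the table stays there as long as it does not meet the grid. -/
lemma mem_table_of_not_onGrid {a b : ℂ} {x y : ℝ}
    (h : ∀ᶠ r : ℝ in 𝓝[>] x, a + r • b ∈ table)
    (hg : ∀ r ∈ Set.Ioo x y, ¬ OnGrid (a + r • b)) {r : ℝ} (hr : r ∈ Set.Icc x y) :
    a + r • b ∈ table := by
  have hc : ∀ i, Continuous fun r : ℝ => bary i (a + r • b) := fun i =>
    (continuous_bary i).comp (by fun_prop)
  refine mem_table.2 fun i => ?_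
  rcases hr.1.eq_or_lt with rfl | hxr
  · refine ge_of_tendsto ((hc i).continuousWithinAt (s := Set.Ioi x)) ?_
    filter_upwards [h] with s hs using mem_table.1 hs i
  · by_contra! hneg
    have h1 : ∀ᶠ s : ℝ in 𝓝[>] x, s ∈ Set.Ioo x r := Ioo_mem_nhdsGT hxr
    obtain ⟨s, hs, hsr⟩ := (h.and h1).exists
    have hs0 := mem_table.1 hs i
    obtain ⟨t, ht, ht0⟩ := intermediate_value_Icc' hsr.2.le (hc i).continuousOn ⟨hneg.le, hs0⟩
    have htr : t ≠ r := by
      rintro rfl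
      exact hneg.ne ht0
    exact hg t ⟨hsr.1.trans_le ht.1, (lt_of_le_of_ne ht.2 htr).trans_le hr.2⟩
      ⟨i, 0, by simpa using ht0⟩

lemma le_of_steps {t : ℕ → ℝ} {m : ℕ} (h : ∀ i ≤ m, t i < t (i + 1)) {i k : ℕ} (hik : i ≤ k)
    (hk : k ≤ m + 1) : t i ≤ t k := by
  induction k, hik using Nat.le_induction with
  | base => exact le_rfl
  | succ k hik ih => exact (ih (by omega)).trans (h k (by omega)).le

lemma not_mem_bumper_of_strikes {β : ℝ → ℂ} {m : ℕ} {t : ℕ → ℝ}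
    (hmono : ∀ i ≤ m, t i < t (i + 1))
    (hstr : ∀ r ∈ Set.Icc (t 0) (t (m + 1)), β r ∈ bumper ↔ ∃ i ≤ m + 1, t i = r)
    {j : ℕ} (hj : j ≤ m) {r : ℝ} (hr : r ∈ Set.Ioo (t j) (t (j + 1))) : β r ∉ bumper := by
  intro hb
  have h1 := le_of_steps hmono (Nat.zero_le j) (by omega)
  have h2 := le_of_steps hmono (show j + 1 ≤ m + 1 by omega) le_rfl
  obtain ⟨i, hi, rfl⟩ := (hstr r ⟨h1.trans hr.1.le, hr.2.le.trans h2⟩).1 hb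
  rcases Nat.lt_or_ge j i with hij | hij
  · exact absurd (le_of_steps hmono (show j + 1 ≤ i by omega) hi) (not_le.2 hr.2)
  · exact absurd (le_of_steps hmono hij (by omega)) (not_le.2 hr.1)

/-- Between two strikes, the reflections of the unfolding process map the table onto the triangle
that contains the unfolded line. -/
lemma unfoldIsom_inv_mem_table {β : ℝ → ℂ} {P w : ℂ} (hw : w ≠ 0) (hβ : ∀ t, β t ∈ table)
    (hc : ∀ t : ℝ, Cong (P + t • w) (β t)) (hav : Avoids P w) {m : ℕ} {t : ℕ → ℝ}
    {s : ℕ → Fin 3} (hmono : ∀ i ≤ m, t i < t (i + 1))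
    (hstr : ∀ r ∈ Set.Icc (t 0) (t (m + 1)), β r ∈ bumper ↔ ∃ i ≤ m + 1, t i = r)
    (hside : ∀ i ≤ m, β (t (i + 1)) ∈ side (s i))
    (hdep : ∀ᶠ r : ℝ in 𝓝[>] (t 0), P + r • w ∈ table) {j : ℕ} (hj : j ≤ m) :
    ∀ r ∈ Set.Icc (t j) (t (j + 1)), (unfoldIsom s j)⁻¹ (P + r • w) ∈ table := by
  have hcj : ∀ j (r : ℝ), Cong ((unfoldIsom s j)⁻¹ (P + r • w)) (β r) := fun j r =>
    (Cong.symm ⟨_, inv_mem (unfoldIsom_mem s j), rfl⟩).trans (hc r)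
  have stay : ∀ j ≤ m, (∀ᶠ r : ℝ in 𝓝[>] (t j), (unfoldIsom s j)⁻¹ (P + r • w) ∈ table) →
      ∀ r ∈ Set.Icc (t j) (t (j + 1)), (unfoldIsom s j)⁻¹ (P + r • w) ∈ table := by
    intro j hj h r hr
    simp only [isom_line] at h ⊢
    refine mem_table_of_not_onGrid h (fun r hr hg => ?_) hr
    rw [← isom_line] at hg
    exact not_mem_bumper_of_strikes hmono hstr hj hr (((hcj j r).mem_bumper_iff (hβ r)).2 hg)
  refine stay j hj ?_
  induction j with
  | zero => simpa [unfoldIsom] using hdep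
  | succ j ih =>
    have hin := stay j (by omega) (ih (by omega))
    have hlt := hmono j (by omega)
    set τ := t (j + 1) with hτ
    set g := (unfoldIsom s j)⁻¹ with hg
    set b := g w - g 0 with hb
    have hline : ∀ r : ℝ, g (P + r • w) = β τ + (r - τ) • b := fun r => by
      rw [(hcj j τ).eq_of_mem_table (hin τ ⟨hlt.le, le_rfl⟩) (hβ τ), ← isom_line,
        line_shift P w τ r]
    have hq := hside j (by omega)
    have havb : Avoids (β τ) b := fun r hr => by
      have h1 := hline (r + τ)
      rw [add_sub_cancel_right] at h1
      rw [← h1, extWeyl_apply_mem (weyl_le (inv_mem (unfoldIsom_mem s j)))] at hr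
      exact hav _ hr
    have hb0 : b ≠ 0 := by
      rw [← norm_pos_iff, norm_isom_sub, norm_pos_iff]; exact hw
    have hq0 := (mem_side.1 hq).2
    -- Before time `τ` the line was in the table, so it can only be leaving through side `s j`.
    have hneg : slope (s j) b < 0 := by
      have hne : slope (s j) b ≠ 0 := havb.slope_ne_zero hb0 (t := 0) (n := 0) (by simpa using hq0)
      have h1 := mem_table.1 (hin (t j) ⟨le_rfl, hlt.le⟩) (s j)
      rw [hline, bary_line, hq0, zero_add] at h1
      by_contra! hpos
      have h2 := lt_of_le_of_ne hpos hne.symm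
      nlinarith
    have hβv : β τ ∉ vertexLattice := by simpa using havb 0
    -- Just after the strike `refl (s j)` folds the line back into the table, and composing it with
    -- `g` gives the inverse of the next unfolding map.
    have hev := (eventually_fold_eq_of_mem_side hq hβv hneg).2
    have htend : Filter.Tendsto (fun r : ℝ => r - τ) (𝓝[>] τ) (𝓝[≥] 0) :=
      tendsto_nhdsWithin_of_tendsto_nhds_of_eventually_within _
        ((tendsto_sub_nhds τ).mono_left nhdsWithin_le_nhds)
        (by filter_upwards [self_mem_nhdsWithin] with r hr using
              sub_nonneg.2 (le_of_lt (Set.mem_Ioi.1 hr)))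
    filter_upwards [htend.eventually hev] with r hr
    rw [unfoldIsom_succ_inv_apply, hline, refl_line hq, ← hr]
    exact fold_mem _

/-- The inverse of the last unfolding map sends the end of the line segment into the table, to a
point congruent to `P`; this must be `P` itself. Only `m` reflections occur for `m + 1` strikes,
since the return to `P` is not unfolded. -/
lemma unfoldMap_eq_of_strikes {β : ℝ → ℂ} {P w : ℂ} (hw : w ≠ 0) (hβ : ∀ t, β t ∈ table)
    (hc : ∀ t : ℝ, Cong (P + t • w) (β t)) (hav : Avoids P w) {m : ℕ} {t : ℕ → ℝ}
    {s : ℕ → Fin 3} (hmono : ∀ i ≤ m, t i < t (i + 1))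
    (hstr : ∀ r ∈ Set.Icc (t 0) (t (m + 1)), β r ∈ bumper ↔ ∃ i ≤ m + 1, t i = r)
    (hside : ∀ i ≤ m, β (t (i + 1)) ∈ side (s i))
    (hdep : ∀ᶠ r : ℝ in 𝓝[>] (t 0), P + r • w ∈ table) (hP : β (t (m + 1)) = P) :
    unfoldMap s m P = P + t (m + 1) • w := by
  have h := unfoldIsom_inv_mem_table hw hβ hc hav hmono hstr hside hdep le_rfl (t (m + 1))
    ⟨(hmono m le_rfl).le, le_rfl⟩
  have h2 : Cong ((unfoldIsom s m)⁻¹ (P + t (m + 1) • w)) P := by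
    have := hc (t (m + 1))
    rw [hP] at this
    exact (Cong.symm ⟨_, inv_mem (unfoldIsom_mem s m), rfl⟩).trans this
  have h3 := h2.eq_of_mem_table h (hP ▸ hβ _)
  rw [unfoldMap_eq]
  conv_lhs => rw [h3]
  exact isom_apply_inv _ _

lemma Avoids.of_cong {q w q' w' : ℂ} (h : Avoids q w)
    (hc : ∀ s : ℝ, Cong (q + s • w) (q' + s • w')) : Avoids q' w' := fun s hs =>
  h s ((hc s).mem_vertexLattice_iff.1 hs)

/-- The displacement of an unfolding. -/
lemma IsUnfolding.spec {α : PeriodicOrbit} {P Q p w : ℂ} (h : IsUnfolding α P Q)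
    (hl : ∀ t : ℝ, Cong (p + t • w) (α.traj t)) :
    ∃ v : ℂ, SymRel w v ∧ InCone v ∧ v ≠ 0 ∧ Q = P + α.duration • v ∧
      ∀ t : ℝ, Cong (P + t • v) (P + (t + α.duration) • v) := by
  obtain ⟨β, hβ, h0, hP, ⟨v, hdep, harg1, harg2⟩, m, t, s, ht0, htm, hmono, hstr, hside, hQ⟩ := h
  obtain ⟨hv0, hcone⟩ := inCone_of_arg harg1 harg2
  obtain ⟨q, v', hsym, hav, hc⟩ := hβ.exists_line hl
  -- The direction `v` describes the presentation only just after departure, but an interval of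
  -- parameters suffices to match the two lines by one group element.
  have hcount : {r : ℝ | Cong (q + r • v') (P + r • v)} ∈ 𝓝[≥] (0 : ℝ) := by
    filter_upwards [hdep] with r hr
    have := hc r
    rwa [hr] at this
  obtain ⟨g, hg, hgl⟩ := exists_weyl_line (not_countable_of_nhdsGE hcount)
  have hcP : ∀ r : ℝ, Cong (P + r • v) (β r) := fun r =>
    (Cong.symm ⟨g, hg, hgl r⟩).trans (hc r)
  have hv : v = g v' - g 0 := by
    have h1 := hgl 1
    have h2 := hgl 0
    rw [isom_line] at h1 h2
    simp only [one_smul, zero_smul, add_zero] at h1 h2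
    rw [h2] at h1
    exact (add_left_cancel h1).symm
  have havP : Avoids P v := hav.of_cong fun r => ⟨g, hg, hgl r⟩
  refine ⟨v, hsym.trans ⟨g, weyl_le hg, 1, Or.inl rfl, by rw [one_smul, hv]⟩, hcone, hv0, ?_,
    fun r => ?_⟩
  · rw [hQ, ← htm]
    refine unfoldMap_eq_of_strikes hv0 hβ.mem_table hcP havP hmono ?_ hside ?_ ?_
    · rwa [ht0, htm]
    · rw [ht0]
      filter_upwards [nhdsWithin_mono 0 Set.Ioi_subset_Ici_self hdep] with r hr
      rw [← hr]
      exact hβ.mem_table r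
    · rw [htm, ← h0]
      simpa using hβ.add_duration 0
  · have h1 := hcP (r + α.duration)
    rw [hβ.add_duration] at h1
    exact (hcP r).trans h1.symm

lemma exists_enumeration {S : Set ℝ} (hS : S.Finite) {a b : ℝ} (hab : a < b) (ha : a ∈ S)
    (hb : b ∈ S) (hSab : S ⊆ Set.Icc a b) :
    ∃ (m : ℕ) (t : ℕ → ℝ), t 0 = a ∧ t (m + 1) = b ∧ (∀ i ≤ m, t i < t (i + 1)) ∧
      ∀ r, r ∈ S ↔ ∃ i ≤ m + 1, t i = r := by
  set A := hS.toFinset with hA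
  have hmem : ∀ r, r ∈ A ↔ r ∈ S := fun r => by simp [hA]
  have hcard : 1 < A.card := Finset.one_lt_card.2 ⟨a, (hmem a).2 ha, b, (hmem b).2 hb, hab.ne⟩
  obtain ⟨m, hm⟩ : ∃ m, A.card = m + 2 := ⟨A.card - 2, by omega⟩
  set e := A.orderEmbOfFin hm with he
  have heS : ∀ i, e i ∈ S := fun i => (hmem _).1 (A.orderEmbOfFin_mem hm i)
  have hsurj : ∀ r, r ∈ S → ∃ i, e i = r := fun r hr => by
    have := A.range_orderEmbOfFin hm
    have h2 : r ∈ Set.range e := by rw [he, this]; exact (hmem r).2 hr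
    exact h2
  have ht : ∀ i (hi : i < m + 2), (if h : i < m + 2 then e ⟨i, h⟩ else 0) = e ⟨i, hi⟩ :=
    fun i hi => dif_pos hi
  refine ⟨m, fun i => if h : i < m + 2 then e ⟨i, h⟩ else 0, ?_, ?_, fun i hi => ?_, fun r => ?_⟩
  · simp only [ht 0 (by omega)]
    obtain ⟨i, hi⟩ := hsurj a ha
    refine le_antisymm ?_ (hSab (heS _)).1
    conv_rhs => rw [← hi]
    exact e.monotone (Fin.mk_le_of_le_val (Nat.zero_le _))
  · simp only [ht (m + 1) (by omega)]
    obtain ⟨i, hi⟩ := hsurj b hb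
    refine le_antisymm (hSab (heS _)).2 ?_
    conv_lhs => rw [← hi]
    refine e.monotone ?_
    rw [Fin.le_def]
    have := i.2
    simp only
    omega
  · simp only [ht i (by omega), ht (i + 1) (by omega)]
    exact e.strictMono (by simp [Fin.lt_def])
  · constructor
    · intro hr
      obtain ⟨i, rfl⟩ := hsurj r hr
      exact ⟨i, by have := i.2; omega, by simp only [ht i i.2]⟩
    · rintro ⟨i, hi, rfl⟩
      simp only [ht i (by omega)]
      exact heS _

/-- A presentation that starts on `BC` and unfolds to a line in the cone gives an unfolding. -/
lemma PeriodicOrbit.IsPresentation.isUnfolding {α : PeriodicOrbit} {β : ℝ → ℂ}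
    (hβ : α.IsPresentation β) {P v : ℂ} (hP : P ∈ side 0) (h0 : β 0 = P) (hv0 : v ≠ 0)
    (hv : InCone v) (hav : Avoids P v) (hc : ∀ t : ℝ, Cong (P + t • v) (β t)) :
    IsUnfolding α P (P + α.duration • v) := by
  have hT := α.duration_pos
  have hPv : P ∉ vertexLattice := by simpa using hav 0
  have hP' := mem_side.1 hP
  have hdep : ∀ᶠ r : ℝ in 𝓝[≥] 0, P + r • v ∈ table := by
    have : ∀ᶠ r : ℝ in 𝓝 0, ∀ j, j ≠ 0 → 0 < bary j (P + r • v) := by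
      refine Filter.eventually_all.2 fun j => ?_
      by_cases hj : j = 0
      · simp [hj]
      · filter_upwards [eventually_bary_pos (w := v) (bary_pos_of_mem_side hP hPv hj)] with r hr _
        exact hr
    filter_upwards [nhdsWithin_le_nhds this, self_mem_nhdsWithin] with r hr hr0
    refine EquilateralBilliards.mem_table.2 fun j => ?_
    by_cases hj : j = 0
    · rw [hj, bary_line, hP'.2, zero_add]
      exact mul_nonneg hr0 (hv.cy_pos hv0).le
    · exact (hr j hj).le
  have hcT : ∀ t : ℝ, Cong (P + t • v) (P + (t + α.duration) • v) := fun t => by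
    have h1 := hc (t + α.duration)
    rw [hβ.add_duration] at h1
    exact (hc t).trans h1.symm
  have hlat : (2 * α.duration) • v ∈ rootLattice := by
    rcases exists_translation hv0 hcT with h1 | h1
    · rw [two_mul, add_smul]; exact rootLattice.add_mem h1 h1
    · exact h1.1
  have hbump : ∀ r, β r ∈ bumper ↔ OnGrid (P + r • v) := fun r =>
    (hc r).mem_bumper_iff (hβ.mem_table r)
  have hfin : {r | r ∈ Set.Icc 0 α.duration ∧ β r ∈ bumper}.Finite := by
    -- Two runs give a lattice displacement even for a glide reflection, and their half-open
    -- interval contains the closed interval of one run.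
    refine (hav.strikes hv0 (by positivity) (rootLattice_le hlat) 0).1.subset ?_
    rintro r ⟨⟨h1, h2⟩, h3⟩
    exact ⟨⟨h1, by linarith⟩, (hbump r).1 h3⟩
  have hPb : P ∈ bumper := Set.mem_iUnion.2 ⟨0, hP⟩
  have hβT : β α.duration = P := by
    rw [← h0]
    simpa using hβ.add_duration 0
  obtain ⟨m, t, ht0, htm, hmono, hmem⟩ := exists_enumeration hfin hT
    ⟨⟨le_rfl, hT.le⟩, by rwa [h0]⟩ ⟨⟨hT.le, le_rfl⟩, by rwa [hβT]⟩ (fun r hr => hr.1)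
  have hs : ∀ i, ∃ j, i ≤ m → β (t (i + 1)) ∈ side j := fun i => by
    by_cases hi : i ≤ m
    · obtain ⟨j, hj⟩ := Set.mem_iUnion.1 ((hmem _).2 ⟨i + 1, by omega, rfl⟩).2
      exact ⟨j, fun _ => hj⟩
    -- Indices beyond `m` play no role, so any side will do.
    · exact ⟨0, fun h => absurd h hi⟩
  choose s hs using hs
  have hstr : ∀ r ∈ Set.Icc 0 α.duration, β r ∈ bumper ↔ ∃ i ≤ m + 1, t i = r := fun r hr => by
    rw [← hmem]
    exact ⟨fun h => ⟨hr, h⟩, fun h => h.2⟩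
  refine ⟨β, hβ, h0, hP, ⟨v, ?_, hv.arg hv0⟩, m, t, s, ht0, htm, hmono, hstr, hs, ?_⟩
  · filter_upwards [hdep] with r hr
    exact (hc r).eq_of_mem_table hr (hβ.mem_table r)
  · rw [← htm]
    symm
    refine unfoldMap_eq_of_strikes hv0 hβ.mem_table hc hav hmono ?_ hs ?_ ?_
    · rwa [ht0, htm]
    · rw [ht0]
      exact nhdsWithin_mono 0 Set.Ioi_subset_Ici_self hdep
    · rw [htm, hβT]

/-! ### Every periodic orbit has an unfolding -/

/-- The three rotations of the triangle represent the three cosets of `rootLattice` in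
`vertexLattice`. Thus every element of `extWeyl` is such a rotation, which only relabels the
vertices, times an element of `weyl`. -/
lemma exists_rotation {c : ℂ} (hc : c ∈ vertexLattice) : ∃ d ∈ extWeyl, d 0 - c ∈ rootLattice ∧
    ∃ π : Equiv.Perm (Fin 3), ∀ i, d (vertex i) = vertex (π i) := by
  obtain ⟨m, n, rfl⟩ := hc
  have hmod : 3 ∣ m - n ∨ 3 ∣ m - n - 1 ∨ 3 ∣ m - n + 1 := by omega
  rcases hmod with h | h | h
  · refine ⟨1, one_mem _, ⟨-m, -n, by omega, ?_⟩, 1, fun i => rfl⟩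
    push_cast
    simp
    ring
  · obtain ⟨d, hd, hdz⟩ := exists_mem_extWeyl_mul (c := 1) apex_sub_one_cube ⟨1, 0, by simp⟩
    refine ⟨d, hd, ⟨1 - m, -n, by omega, by rw [hdz]; push_cast; ring⟩, Equiv.addRight 1,
      fun i => ?_⟩
    rw [hdz]
    fin_cases i <;> simp [vertex]
    linear_combination apex_sq
  · obtain ⟨d, hd, hdz⟩ := exists_mem_extWeyl_mul (c := apex) neg_apex_cube ⟨0, 1, by simp⟩
    refine ⟨d, hd, ⟨-m, 1 - n, by omega, by rw [hdz]; push_cast; ring⟩, Equiv.addRight 2,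
      fun i => ?_⟩
    rw [hdz]
    fin_cases i <;> simp [vertex]
    linear_combination - apex_sq

lemma PeriodicOrbit.exists_isUnfolding (α : PeriodicOrbit) : ∃ P Q, IsUnfolding α P Q := by
  obtain ⟨p, w, hw, hl⟩ := α.isTrajectory.exists_line
  obtain ⟨v, ⟨g, hg, ε, hε, hv⟩, hcone⟩ := exists_inCone w
  have hv0 : v ≠ 0 := by
    rw [← norm_pos_iff, hv, norm_smul, norm_isom_sub]
    have := norm_pos_iff.2 hw
    rcases hε with rfl | rfl <;> simpa
  have hcy := hcone.cy_pos hv0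
  -- The parameter at which the line, turned into the cone, crosses the horizontal line through `B`;
  -- subtracting the integer `n` then brings the crossing onto `BC`.
  set s := - cy (g p) / cy v with hs
  set n := ⌊cx (g p + s • v)⌋ with hn
  obtain ⟨τ, hτ, hτz⟩ := exists_mem_extWeyl_mul (u := 1) (c := -n) (by simp)
    ⟨-n, 0, by simp⟩
  set P := g p + s • v - n with hP
  have hh : τ * g ∈ extWeyl := mul_mem hτ hg
  have hline : ∀ r : ℝ, P + r • v = (τ * g) (p + (ε * s + ε * r) • w) := fun r => by
    rw [isom_mul_apply, isom_line g, hτz, ← mul_add, mul_comm ε, mul_smul, ← hv, add_smul, hP]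
    ring
  have hPside : P ∈ side 0 := by
    have hy : cy P = 0 := by
      rw [hP, map_sub, map_add, map_smul, cy_intCast, hs, smul_eq_mul, div_mul_cancel₀ _ hcy.ne']
      ring
    have hx : cx P = Int.fract (cx (g p + s • v)) := by
      rw [hP, map_sub, cx_intCast, hn, Int.fract]
    rw [mem_side, mem_table_iff, hy, hx]
    refine ⟨⟨Int.fract_nonneg _, le_rfl, ?_⟩, by simpa [bary] using hy⟩
    rw [add_zero]
    exact (Int.fract_lt_one _).le
  -- The motion `τ * g` need not be in `weyl`. It factors as `d * k` with `k` in `weyl`, and `d`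
  -- becomes the relabelling of the presentation.
  obtain ⟨d, hd, hd0, π, hπ⟩ := exists_rotation hh.1
  set k := d⁻¹ * (τ * g) with hk
  have hkh : ∀ z, (τ * g) z = d (k z) := fun z => by rw [hk, isom_mul_apply d⁻¹, isom_apply_inv]
  have hkW : k ∈ weyl := by
    have hk' : k ∈ extWeyl := mul_mem (inv_mem hd) hh
    refine ⟨hk', ?_⟩
    have h1 := extWeyl_sub_mem hd hk'.1
    rw [← hkh] at h1
    have := rootLattice.neg_mem (rootLattice.add_mem h1 hd0)
    simpa using this
  have hβ : α.IsPresentation fun r => d (α.traj (ε * s + ε * r)) :=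
    ⟨π, d, ε * s, ε, hπ, hε, fun _ => rfl⟩
  have hc : ∀ r : ℝ, Cong (P + r • v) (d (α.traj (ε * s + ε * r))) := fun r => by
    rw [hline, hkh]
    exact Cong.map ((Cong.symm ⟨k, hkW, rfl⟩).trans (hl _)) hd
  have hav : Avoids P v := fun r hr => by
    rw [hline, extWeyl_apply_mem hh] at hr
    exact α.isTrajectory.avoids hl _ hr
  have h0 := hc 0
  rw [zero_smul, add_zero] at h0
  exact ⟨P, _, hβ.isUnfolding hPside (h0.eq_of_mem_table (mem_side.1 hPside).1 (hβ.mem_table 0))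
    hv0 hcone hav hc⟩

lemma IsUnfolding.mem_side {α : PeriodicOrbit} {P Q : ℂ} (h : IsUnfolding α P Q) : P ∈ side 0 := by
  obtain ⟨_, _, _, hP, _⟩ := h
  exact hP

/-! ### The displacement of a periodic orbit -/

/-- Directions of different unfoldings are related by a symmetry and all lie in the cone, hence
coincide. In the glide case the axis has an inclination that is a multiple of 60 degrees, and only
60 degrees itself is in the cone. -/
lemma PeriodicOrbit.exists_disp (α : PeriodicOrbit) : ∃ D : ℂ,
    (∀ P Q, IsUnfolding α P Q → Q = P + D) ∧ D ≠ 0 ∧ InCone D ∧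
      (α.period : ℝ) = 2 * (cx D + cy D) ∧
      (D ∈ rootLattice ∨ 2 * D ∈ rootLattice ∧ cx D = 0) := by
  obtain ⟨p, w, hw, hl⟩ := α.isTrajectory.exists_line
  obtain ⟨P, Q, hPQ⟩ := α.exists_isUnfolding
  obtain ⟨v, hsym, hcone, hv0, hQ, hc⟩ := hPQ.spec hl
  have hT := α.duration_pos
  have hx := hcone.1
  have hy := hcone.cy_pos hv0
  refine ⟨α.duration • v, fun R S hRS => ?_, smul_ne_zero hT.ne' hv0, ?_, ?_, ?_⟩
  · obtain ⟨v', hsym', hcone', hv0', hS, -⟩ := hRS.spec hl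
    rw [hS, (hsym.symm.trans hsym').eq_of_inCone hcone hcone']
  · constructor
    · rw [map_smul, smul_eq_mul]; positivity
    · rw [map_smul, map_smul, smul_eq_mul, smul_eq_mul]
      exact mul_le_mul_of_nonneg_left hcone.2 hT.le
  · rw [α.period_eq hw hl, hexNorm_smul, ← hsym.hexNorm_eq, ← hexNorm_smul, hexNorm, map_smul,
      map_smul, smul_eq_mul, smul_eq_mul, abs_of_nonneg (by positivity),
      abs_of_nonneg (by positivity), abs_of_nonneg (by positivity)]
    ring
  · rcases exists_translation hv0 hc with h | ⟨h, u, hu, huv⟩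
    · exact Or.inl h
    · refine Or.inr ⟨?_, ?_⟩
      · rw [mul_smul] at h
        simpa using h
      · have h0 : cx v = 0 := by
          have e := congrArg cx huv
          rcases cube_root_cases hu with rfl | rfl | rfl
          · rw [one_mul, cx_conj] at e; linarith
          · rw [sub_one_mul, map_sub, cx_apex_mul, cx_conj, cy_conj] at e; linarith
          · rw [neg_mul, map_neg, cx_apex_mul, cy_conj] at e; linarith
        rw [map_smul, h0, smul_zero]

/-- The displacement from the beginning to the end of the unfoldings of an orbit. -/
def PeriodicOrbit.disp (α : PeriodicOrbit) : ℂ := α.exists_disp.choose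

lemma IsUnfolding.eq_add_disp {α : PeriodicOrbit} {P Q : ℂ} (h : IsUnfolding α P Q) :
    Q = P + α.disp := α.exists_disp.choose_spec.1 P Q h

lemma PeriodicOrbit.disp_ne_zero (α : PeriodicOrbit) : α.disp ≠ 0 :=
  α.exists_disp.choose_spec.2.1

lemma PeriodicOrbit.inCone_disp (α : PeriodicOrbit) : InCone α.disp :=
  α.exists_disp.choose_spec.2.2.1

lemma PeriodicOrbit.period_eq_disp (α : PeriodicOrbit) :
    (α.period : ℝ) = 2 * (cx α.disp + cy α.disp) := α.exists_disp.choose_spec.2.2.2.1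

/-- In the glide case `2 * D` has coordinates `(0, n)`, where `3 ∣ n` and `n` is the period. If `n =
2 * k`, then `D` is `(0, k)` and `3 ∣ k`. -/
lemma PeriodicOrbit.disp_mem_of_even (α : PeriodicOrbit) (h : Even α.period) :
    α.disp ∈ rootLattice := by
  rcases α.exists_disp.choose_spec.2.2.2.2 with h1 | ⟨⟨m, n, hmn, h2⟩, h0⟩
  · exact h1
  · change 2 * α.disp = _ at h2
    change cx α.disp = 0 at h0
    have h2' : ((2 : ℝ) : ℂ) * α.disp = m + n * apex := by exact_mod_cast h2
    have hm : (0 : ℝ) = m := by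
      have := congrArg cx h2'
      rwa [cx_ofReal_mul, cx_int_add_mul, h0, mul_zero] at this
    have hn : 2 * cy α.disp = n := by
      have := congrArg cy h2'
      rwa [cy_ofReal_mul, cy_int_add_mul] at this
    have hm' : m = 0 := by exact_mod_cast hm.symm
    have hp : (α.period : ℝ) = n := by rw [α.period_eq_disp, h0, zero_add, hn]
    have hp' : (α.period : ℤ) = n := by exact_mod_cast hp
    obtain ⟨k, hk⟩ := h
    refine ⟨0, k, by omega, ?_⟩
    have hnk : n = 2 * k := by omega
    rw [eq_cx_add_cy α.disp, h0]
    have : cy α.disp = k := by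
      rw [hnk] at hn
      push_cast at hn
      linarith
    rw [this]
    simp

lemma eq_ofReal_of_mem_side {P : ℂ} (h : P ∈ side 0) : P = cx P := by
  have h0 : cy P = 0 := by simpa [bary] using (mem_side.1 h).2
  conv_lhs => rw [eq_cx_add_cy P, h0]
  simp

/-- All unfoldings begin on the horizontal side `BC`, so two of them are horizontal translates as
soon as their displacements agree. -/
lemma orbitEquiv_iff {α β : PeriodicOrbit} : OrbitEquiv α β ↔ α.disp = β.disp := by
  constructor
  · rintro ⟨P, Q, R, S, h1, h2, h, rfl, rfl⟩
    have e1 := h1.eq_add_disp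
    have e2 := h2.eq_add_disp
    linear_combination e2 - e1
  · intro h
    obtain ⟨P, Q, h1⟩ := α.exists_isUnfolding
    obtain ⟨R, S, h2⟩ := β.exists_isUnfolding
    refine ⟨P, Q, R, S, h1, h2, cx R - cx P, ?_, ?_⟩
    · rw [eq_ofReal_of_mem_side h1.mem_side, eq_ofReal_of_mem_side h2.mem_side]
      simp
    · rw [h1.eq_add_disp, h2.eq_add_disp, h]
      push_cast
      rw [← eq_ofReal_of_mem_side h1.mem_side, ← eq_ofReal_of_mem_side h2.mem_side]
      ring

lemma equivalence_orbitEquiv : Equivalence OrbitEquiv := by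
  refine ⟨fun α => orbitEquiv_iff.2 rfl, fun h => ?_, fun h h' => ?_⟩
  · exact orbitEquiv_iff.2 (orbitEquiv_iff.1 h).symm
  · exact orbitEquiv_iff.2 ((orbitEquiv_iff.1 h).trans (orbitEquiv_iff.1 h'))

lemma toClass_eq_iff {α β : PeriodicOrbit} : α.toClass = β.toClass ↔ α.disp = β.disp := by
  rw [← orbitEquiv_iff]
  exact equivalence_orbitEquiv.quot_mk_eq_iff α β

lemma period_eq_of_disp_eq {α β : PeriodicOrbit} (h : α.disp = β.disp) : α.period = β.period := by
  have : (α.period : ℝ) = β.period := by rw [α.period_eq_disp, β.period_eq_disp, h]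
  exact_mod_cast this

lemma hasPeriod_toClass (α : PeriodicOrbit) : α.toClass.HasPeriod α.period := fun _ h =>
  period_eq_of_disp_eq (toClass_eq_iff.1 h)

lemma OrbitClass.IsEven.disp_mem {c : OrbitClass} (hc : c.IsEven) {α : PeriodicOrbit}
    (hα : α.toClass = c) : α.disp ∈ rootLattice := by
  obtain ⟨k, hk, h⟩ := hc
  exact α.disp_mem_of_even (h α hα ▸ hk)

/-! ### Orbits with a given unfolding -/

/-- The tessellation is invariant under translation by `D`, so a vertex anywhere on the line gives
one on the segment, at the fractional part of its parameter. -/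
lemma avoids_of_segment {O D : ℂ} (hD : D ∈ rootLattice)
    (h : ∀ z ∈ segment ℝ O (O + D), z ∉ tessellationVertices) : Avoids O D := by
  intro t ht
  refine h (O + Int.fract t • D) ?_ ?_
  · rw [segment_eq_image']
    exact ⟨Int.fract t, ⟨Int.fract_nonneg t, (Int.fract_lt_one t).le⟩, by simp⟩
  · have h1 := vertexLattice.sub_mem ht (vertexLattice.zsmul_mem (rootLattice_le hD) ⌊t⌋)
    have h2 : O + t • D - ⌊t⌋ • D = O + Int.fract t • D := by
      rw [Int.fract, sub_smul, Int.cast_smul_eq_zsmul]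
      ring
    rwa [h2] at h1

/-- Translation by `D` belongs to `weyl`, so the folded line is periodic with duration 1. -/
lemma exists_orbit {O D : ℂ} (hO : O ∈ side 0) (hD : InCone D) (hD0 : D ≠ 0)
    (hDL : D ∈ rootLattice) (h : ∀ z ∈ segment ℝ O (O + D), z ∉ tessellationVertices) :
    ∃ α : PeriodicOrbit, IsUnfolding α O (O + D) := by
  have hav := avoids_of_segment hDL h
  obtain ⟨g, hg, hgz⟩ := exists_mem_extWeyl_mul (u := 1) (by simp) (rootLattice_le hDL)
  have hgW : g ∈ weyl := ⟨hg, by simpa [hgz] using hDL⟩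
  let α : PeriodicOrbit :=
    { traj := fun t => fold (O + t • D)
      initial := 0
      final := 1
      initial_lt_final := one_pos
      isTrajectory := isTrajectory_fold hD0 hav
      periodic := fun t => Cong.fold_congr ⟨g, hgW, by
        rw [hgz, add_smul, add_smul, zero_smul, one_smul]; ring⟩ }
  have hβ : α.IsPresentation fun t => fold (O + t • D) :=
    ⟨1, AffineIsometryEquiv.refl ℝ ℂ, 0, 1, fun i => rfl, Or.inl rfl, fun t => by simp [α]⟩
  have hdur : α.duration = 1 := sub_zero _
  have hc : ∀ t : ℝ, Cong (O + t • D) (fold (O + t • D)) := fun t => cong_fold _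
  have := hβ.isUnfolding hO (by
    rw [zero_smul, add_zero]
    exact (Cong.refl O).fold_eq (mem_side.1 hO).1) hD0 hD hav hc
  rw [hdur, one_smul] at this
  exact ⟨α, this⟩

/-- A line through a lattice point in the direction of a lattice vector meets the horizontal axis in
a rational point. -/
lemma not_mem_of_irrational {x : ℝ} (hx : Irrational x) {D : ℂ} (hD : InCone D) (hD0 : D ≠ 0)
    (hDL : D ∈ rootLattice) {z : ℂ} (hz : z ∈ segment ℝ (x : ℂ) (x + D)) :
    z ∉ tessellationVertices := by
  rintro ⟨m, n, hmn⟩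
  rw [segment_eq_image'] at hz
  obtain ⟨t, -, rfl⟩ := hz
  have hb := hD.cy_pos hD0
  obtain ⟨a, b, -, rfl⟩ := hDL
  change (x : ℂ) + t • (x + (a + b * apex) - x) = _ at hmn
  rw [add_sub_cancel_left] at hmn
  have e1 := congrArg cx hmn
  have e2 := congrArg cy hmn
  rw [map_add, map_smul, cx_ofReal, cx_int_add_mul, cx_int_add_mul, smul_eq_mul] at e1
  rw [map_add, map_smul, cy_ofReal, cy_int_add_mul, cy_int_add_mul, smul_eq_mul] at e2
  rw [cy_int_add_mul] at hb
  apply hx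
  refine ⟨m - n / b * a, ?_⟩
  push_cast
  rw [← e2, ← e1]
  field_simp
  ring

lemma ofReal_mem_side {x : ℝ} (h0 : 0 ≤ x) (h1 : x ≤ 1) : (x : ℂ) ∈ side 0 := by
  rw [mem_side, mem_table_iff]
  simp [bary, h0, h1]

lemma isOrigin_of_irrational {x : ℝ} (hx : Irrational x) (h0 : 0 ≤ x) (h1 : x ≤ 1) :
    IsOrigin (x : ℂ) := by
  refine ⟨ofReal_mem_side h0 h1, fun h => ?_, fun c hc => ?_⟩
  · apply hx
    have := congrArg Complex.re h
    refine ⟨1 / 2, ?_⟩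
    simp [vertex, midpoint_eq_smul_add] at this
    push_cast
    linarith
  · rintro ⟨α, P, Q, hα, hPQ, z, hz, hzv⟩
    rw [hPQ.eq_add_disp, add_sub_cancel_left] at hz
    exact not_mem_of_irrational hx α.inCone_disp α.disp_ne_zero (hc.disp_mem hα) hz hzv

/-- Uniqueness holds because the displacement is an invariant of the class; nonsingularity of `O` is
what `exists_orbit` needs to realize that displacement from `O`. -/
lemma IsOrigin.isFundamentalUnfolding_iff {O : ℂ} (hO : IsOrigin O) {α : PeriodicOrbit}
    (hα : α.toClass.IsEven) {S : ℂ} :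
    IsFundamentalUnfolding O α.toClass S ↔ S = O + α.disp := by
  constructor
  · rintro ⟨β, hβ, h⟩
    rw [h.eq_add_disp, toClass_eq_iff.1 hβ]
  · rintro rfl
    obtain ⟨P, Q, hPQ⟩ := α.exists_isUnfolding
    obtain ⟨β, hβ⟩ := exists_orbit hO.1 α.inCone_disp α.disp_ne_zero (hα.disp_mem rfl)
      fun z hz hzv => hO.2.2 _ hα ⟨α, P, Q, rfl, hPQ, z, by
        rwa [hPQ.eq_add_disp, add_sub_cancel_left], hzv⟩
    exact ⟨β, toClass_eq_iff.2 (add_left_cancel hβ.eq_add_disp).symm, hβ⟩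

lemma exists_latticePoint {n : ℕ} {α : PeriodicOrbit} (h : α.period = 2 * n) :
    ∃ p : latticePoints n, α.disp = p.1.1 + p.1.2 * apex := by
  have hmem := α.disp_mem_of_even ⟨n, by omega⟩
  have hper := α.period_eq_disp
  have hcone := α.inCone_disp
  obtain ⟨x, y, hxy, hD⟩ := hmem
  rw [hD, InCone, cx_int_add_mul, cy_int_add_mul] at hcone
  rw [hD, h, cx_int_add_mul, cy_int_add_mul] at hper
  have h1 : 0 ≤ x := by exact_mod_cast hcone.1
  have h2 : x ≤ y := by exact_mod_cast hcone.2
  have h3 : ((2 * n : ℕ) : ℤ) = 2 * (x + y) := by exact_mod_cast hper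
  refine ⟨⟨(x, y), h1, h2, ?_, ?_⟩, hD⟩
  · change x ≡ y [ZMOD 3]
    rw [Int.modEq_iff_dvd]
    omega
  · change x + y = n
    push_cast at h3
    omega

lemma exists_orbit_of_latticePoint {n : ℕ} (hn : 1 ≤ n) (p : latticePoints n) :
    ∃ α : PeriodicOrbit, α.period = 2 * n ∧ α.disp = p.1.1 + p.1.2 * apex := by
  obtain ⟨⟨x, y⟩, h1, h2, h3, h4⟩ := p
  simp only at h1 h2 h3 h4 ⊢
  rw [Int.modEq_iff_dvd] at h3
  have hcone : InCone (x + y * apex) := by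
    rw [InCone, cx_int_add_mul, cy_int_add_mul]
    exact ⟨by exact_mod_cast h1, by exact_mod_cast h2⟩
  have hne : (x + y * apex : ℂ) ≠ 0 := fun h => by
    have := congrArg cy h
    rw [cy_int_add_mul, map_zero] at this
    have : y = 0 := by exact_mod_cast this
    omega
  have hL : (x + y * apex : ℂ) ∈ rootLattice := ⟨x, y, by omega, rfl⟩
  -- Any nonsingular starting point would serve to realize the displacement; an irrational one
  -- always works.
  obtain ⟨r, hr, hr0, hr1⟩ := exists_irrational_btwn (zero_lt_one (α := ℝ))
  obtain ⟨α, hα⟩ := exists_orbit (ofReal_mem_side hr0.le hr1.le) hcone hne hL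
    fun z hz => not_mem_of_irrational hr hcone hne hL hz
  have hD : α.disp = x + y * apex := (add_left_cancel hα.eq_add_disp).symm
  refine ⟨α, ?_, hD⟩
  have := α.period_eq_disp
  rw [hD, cx_int_add_mul, cy_int_add_mul] at this
  have h5 : (α.period : ℤ) = 2 * (x + y) := by exact_mod_cast this
  omega

lemma exists_bijection {O : ℂ} (hO : IsOrigin O) {n : ℕ} (hn : 1 ≤ n) :
    ∃ Φ : {c : OrbitClass // c.HasPeriod (2 * n)} → latticePoints n, Function.Bijective Φ ∧
      ∀ (c : {c : OrbitClass // c.HasPeriod (2 * n)}) (S : ℂ),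
        IsFundamentalUnfolding O c.1 S ↔
          S = rhombicPoint O ((Φ c).1.1 : ℝ) ((Φ c).1.2 : ℝ) := by
  have hex : ∀ c : {c : OrbitClass // c.HasPeriod (2 * n)}, ∃ (p : latticePoints n)
      (α : PeriodicOrbit), α.toClass = c.1 ∧ α.disp = p.1.1 + p.1.2 * apex := fun c => by
    obtain ⟨α, hα⟩ := Quot.exists_rep c.1
    obtain ⟨p, hp⟩ := exists_latticePoint (c.2 α hα)
    exact ⟨p, α, hα, hp⟩
  choose Φ A hA hD using hex
  refine ⟨Φ, ⟨fun c c' h => ?_, fun p => ?_⟩, fun c S => ?_⟩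
  · apply Subtype.ext
    rw [← hA, ← hA, toClass_eq_iff, hD, hD, h]
  · obtain ⟨α, hper, hα⟩ := exists_orbit_of_latticePoint hn p
    have hc : α.toClass.HasPeriod (2 * n) := hper ▸ hasPeriod_toClass α
    refine ⟨⟨α.toClass, hc⟩, Subtype.ext ?_⟩
    -- The chosen representative of the class may differ from `α`, but it has the same displacement,
    -- and the coordinates are read off from that.
    have h := toClass_eq_iff.1 (hA ⟨α.toClass, hc⟩)
    rw [hD, hα] at h
    have e1 := congrArg cx h
    have e2 := congrArg cy h
    rw [cx_int_add_mul, cx_int_add_mul] at e1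
    rw [cy_int_add_mul, cy_int_add_mul] at e2
    exact Prod.ext (by exact_mod_cast e1) (by exact_mod_cast e2)
  · have heven : (A c).toClass.IsEven := ⟨2 * n, even_two_mul n, hA c ▸ c.2⟩
    rw [← hA c, hO.isFundamentalUnfolding_iff heven, hD, rhombicPoint]
    push_cast
    rw [add_assoc]

end EquilateralBilliards

end

theorem theorem3p2 :
    Equivalence EquilateralBilliards.OrbitEquiv ∧
    (∀ α β : EquilateralBilliards.PeriodicOrbit,
      EquilateralBilliards.OrbitEquiv α β → α.period = β.period) ∧
    (∃ O : ℂ, EquilateralBilliards.IsOrigin O) ∧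
    ∀ O : ℂ, EquilateralBilliards.IsOrigin O →
      (∀ c : EquilateralBilliards.OrbitClass, c.IsEven →
        ∃! S : ℂ, EquilateralBilliards.IsFundamentalUnfolding O c S) ∧
      ∀ n : ℕ, 1 ≤ n →
        ∃ Φ : {c : EquilateralBilliards.OrbitClass // c.HasPeriod (2 * n)} →
            EquilateralBilliards.latticePoints n,
          Function.Bijective Φ ∧
          ∀ (c : {c : EquilateralBilliards.OrbitClass // c.HasPeriod (2 * n)}) (S : ℂ),
            EquilateralBilliards.IsFundamentalUnfolding O c.1 S ↔
              S = EquilateralBilliards.rhombicPoint O ((Φ c).1.1 : ℝ) ((Φ c).1.2 : ℝ) := by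
  refine ⟨EquilateralBilliards.equivalence_orbitEquiv, fun α β h => ?_, ?_, fun O hO => ⟨?_, ?_⟩⟩
  · exact EquilateralBilliards.period_eq_of_disp_eq (EquilateralBilliards.orbitEquiv_iff.1 h)
  · obtain ⟨x, hx, h0, h1⟩ := exists_irrational_btwn (zero_lt_one (α := ℝ))
    exact ⟨x, EquilateralBilliards.isOrigin_of_irrational hx h0.le h1.le⟩
  · intro c hc
    obtain ⟨α, rfl⟩ := Quot.exists_rep c
    exact ⟨O + α.disp, (hO.isFundamentalUnfolding_iff hc).2 rfl,
      fun S hS => (hO.isFundamentalUnfolding_iff hc).1 hS⟩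
  · exact fun n hn => EquilateralBilliards.exists_bijection hO hn
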